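/- Let $Q$ be a finite quiver with vertex set $I$, set of arrows also denoted $Q$, and head and tail maps $h,t:Q\to I$. Let $\overline Q$ be its double, with an additional arrow $b^*$ from $h(b)$ to $t(b)$ for every arrow $b$. Let $\mathbb C\overline Q$ be its path algebra (paths are composed from right to left) and let $\mathbb C\overline Q^r$ be the span of the paths containing exactly $r$ dual arrows. Let $\mathcal V Q$ be the quotient of the vector space $\mathbb C\overline Q$ by the linear span of all $PR-(-1)^{pr}RP$ with $P\in\mathbb C\overline Q^p$, $R\in\mathbb C\overline Q^r$, and let $\mathcal V^rQ$ be the image of $\mathbb C\overline Q^r$. (Paths that are not closed are zero in $\mathcal VQ$.) For $c\in\overline Q$ let $D_c:\mathcal VQ\to\mathbb C\overline Q$ be the linear map given on closed paths by $$D_c(x_1\cdots x_n)=\sum_{k:\,x_k=c}(-1)^{\lambda_k\mu_k}\,x_{k+1}\cdots x_nx_1\cdots x_{k-1},$$ where $\lambda_k$ (resp. $\mu_k$) is the number of dual arrows among $x_{k+1},\dots,x_n$ (resp. $x_1,\dots,x_k$), and the empty product is the trivial path at $t(c)$. For $\gamma\in\mathcal V^rQ$, $\delta\in\mathcal V^sQ$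 let $$[\gamma,\delta]=\sum_{b\in Q}\Bigl(D_{b^*}(\gamma)D_b(\delta)-(-1)^{(r-1)(s-1)}D_{b^*}(\delta)D_b(\gamma)\Bigr)\in\mathcal VQ .$$ A Poisson structure on $\mathbb CQ$ is an element $\Pi\in\mathcal V^2Q$ with $[\Pi,\Pi]=0$. Let $a\in Q$ be an arrow whose tail $i=t(a)$ and head $j=h(a)$ are distinct, and let $Q_a$ be the quiver obtained from $Q$ by fusing $i$ and $j$ and deleting $a$. Put $S_j=\{b\in Q: h(b)=j\}$ and $T_j=\{b\in Q: t(b)=j\}$. For $\Pi\in\mathcal VQ$ let $\Pi_a\in\mathcal VQ_a$ be obtained by writing $\Pi$ as a linear combination of closed paths of $\overline Q$ and replacing in each of them $a$ by $1$ and $a^*$ by $$\sum_{b\in T_j}b^*b-\sum_{b\in S_j,\ b\neq a}bb^* .$$ **Proposition.** The element $\Pi_a$ is well defined, and if $\Pi$ is a Poisson structure on $\mathbb CQ$, then $\Pi_a$ is a Poisson structure on $\mathbb CQ_a$. -/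

import Mathlib

noncomputable section

/-- A quiver with vertex set `I` and arrow set `E`: every arrow has a head and a tail. -/
structure ArrowQuiver (I E : Type*) where
  head : E → I
  tail : E → I

namespace ArrowQuiver

universe u v

variable {I : Type u} {E : Type v}

/-- `Q.IsPath i [x₁, …, xₙ] j`: the word `x₁ ⋯ xₙ`, read from right to left, is a path
from `j` to `i`, that is, `i = h(x₁)`, `t(xₖ) = h(xₖ₊₁)` and `t(xₙ) = j`. -/
def IsPath (Q : ArrowQuiver I E) : I → List E → I → Prop
  | i, [], j => i = j
  | i, x :: w, j => i = Q.head x ∧ IsPath Q (Q.tail x) w j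

theorem IsPath.append {Q : ArrowQuiver I E} {u w : List E} {i j k : I}
    (hu : Q.IsPath i u j) (hw : Q.IsPath j w k) : Q.IsPath i (u ++ w) k := by
  induction u generalizing i with
  | nil => obtain rfl : i = j := hu; exact hw
  | cons x u ih => exact ⟨hu.1, ih hu.2⟩

/-- A path of `Q` (trivial paths included): a word of arrows with its two end points. -/
@[ext] structure Path (Q : ArrowQuiver I E) where
  tgt : I
  word : List E
  src : I
  isPath : Q.IsPath tgt word src

namespace Path

variable {Q : ArrowQuiver I E}

/-- The trivial path at a vertex. -/
def triv (Q : ArrowQuiver I E) (i : I) : Q.Path := ⟨i, [], i, rfl⟩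

/-- An arrow, as a path of length one. -/
def ofArrow (Q : ArrowQuiver I E) (x : E) : Q.Path :=
  ⟨Q.head x, [x], Q.tail x, rfl, rfl⟩

/-- Concatenation `p q` of paths: first `q`, then `p`. -/
def comp (p q : Q.Path) (h : p.src = q.tgt) : Q.Path :=
  ⟨p.tgt, p.word ++ q.word, q.src, p.isPath.append (by rw [h]; exact q.isPath)⟩

end Path

/-- The path algebra `ℂQ`: the complex vector space with the paths of `Q` as a basis. Its
product (below) is concatenation of paths, and zero for paths that cannot be concatenated. -/
def PathAlgebra (Q : ArrowQuiver I E) : Type (max u v) := Q.Path →₀ ℂ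

namespace PathAlgebra

variable {Q : ArrowQuiver I E}

instance : AddCommGroup Q.PathAlgebra := inferInstanceAs (AddCommGroup (Q.Path →₀ ℂ))
instance : Module ℂ Q.PathAlgebra := inferInstanceAs (Module ℂ (Q.Path →₀ ℂ))

/-- A path as an element of the path algebra. -/
def of (p : Q.Path) : Q.PathAlgebra := Finsupp.single p (1 : ℂ)

/-- The linear map on the path algebra with prescribed values on the paths. -/
def lift {M : Type*} [AddCommGroup M] [Module ℂ M] (f : Q.Path → M) : Q.PathAlgebra →ₗ[ℂ] M :=
  Finsupp.linearCombination ℂ f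

@[simp] theorem lift_of {M : Type*} [AddCommGroup M] [Module ℂ M] (f : Q.Path → M)
    (p : Q.Path) : lift f (of p) = f p :=
  (Finsupp.linearCombination_single ℂ (1 : ℂ) p).trans (one_smul ℂ _)

theorem induction {P : Q.PathAlgebra → Prop} (x : Q.PathAlgebra) (h0 : P 0)
    (hadd : ∀ x y, P x → P y → P (x + y)) (hof : ∀ (c : ℂ) (p : Q.Path), P (c • of p)) : P x := by
  refine Finsupp.induction_linear (motive := P) x h0 hadd fun p c => ?_
  have h : (Finsupp.single p c : Q.Path →₀ ℂ) = c • Finsupp.single p (1 : ℂ) := by simp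
  exact (congrArg (α := Q.Path →₀ ℂ) P h).mpr (hof c p)

variable [DecidableEq I]

/-- The product of two paths in the path algebra. -/
def pathMul (p q : Q.Path) : Q.PathAlgebra :=
  if h : p.src = q.tgt then of (p.comp q h) else 0

/-- The product of the path algebra, as a bilinear map. -/
def mulMap (Q : ArrowQuiver I E) : Q.PathAlgebra →ₗ[ℂ] Q.PathAlgebra →ₗ[ℂ] Q.PathAlgebra :=
  lift fun p => lift fun q => pathMul p q

instance : Mul Q.PathAlgebra := ⟨fun x y => mulMap Q x y⟩

theorem mul_def (x y : Q.PathAlgebra) : x * y = mulMap Q x y := rfl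

theorem of_mul_of (p q : Q.Path) : of p * of q = pathMul p q := by
  simp [mul_def, mulMap]

theorem of_mul_of_pos (p q : Q.Path) (h : p.src = q.tgt) : of p * of q = of (p.comp q h) := by
  simp [of_mul_of, pathMul, h]

theorem of_mul_of_neg (p q : Q.Path) (h : p.src ≠ q.tgt) : of p * of q = 0 := by
  simp [of_mul_of, pathMul, h]

/-- The idempotent `e_i`. -/
def e (Q : ArrowQuiver I E) (i : I) : Q.PathAlgebra := of (Path.triv Q i)

theorem e_mul_of (i : I) (p : Q.Path) : e Q i * of p = if i = p.tgt then of p else 0 := by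
  by_cases h : i = p.tgt
  · rw [e, of_mul_of_pos _ _ h, if_pos h]
    subst h
    rfl
  · rw [e, of_mul_of_neg _ _ h, if_neg h]

theorem of_mul_e (i : I) (p : Q.Path) : of p * e Q i = if p.src = i then of p else 0 := by
  by_cases h : p.src = i
  · rw [e, of_mul_of_pos _ _ h, if_pos h]
    subst h
    congr 1
    ext <;> simp [Path.comp, Path.triv]
  · rw [e, of_mul_of_neg _ _ h, if_neg h]

theorem smul_mul' (c : ℂ) (x y : Q.PathAlgebra) : c • x * y = c • (x * y) := by
  simp [mul_def]

theorem mul_smul' (c : ℂ) (x y : Q.PathAlgebra) : x * c • y = c • (x * y) := by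
  simp [mul_def]

theorem add_mul' (x y z : Q.PathAlgebra) : (x + y) * z = x * z + y * z := by
  simp [mul_def]

theorem mul_add' (x y z : Q.PathAlgebra) : x * (y + z) = x * y + x * z := by
  simp [mul_def]

theorem zero_mul' (x : Q.PathAlgebra) : 0 * x = 0 := by simp [mul_def]

theorem mul_zero' (x : Q.PathAlgebra) : x * 0 = 0 := by simp [mul_def]

theorem of_mul_assoc (p q r : Q.Path) : of p * of q * of r = of p * (of q * of r) := by
  by_cases h : p.src = q.tgt <;> by_cases h' : q.src = r.tgt
  · rw [of_mul_of_pos p q h, of_mul_of_pos q r h', of_mul_of_pos (p.comp q h) r h',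
      of_mul_of_pos p (q.comp r h') h]
    congr 1
    ext <;> simp [Path.comp]
  · rw [of_mul_of_pos p q h, of_mul_of_neg q r h', of_mul_of_neg (p.comp q h) r h', mul_zero']
  · rw [of_mul_of_neg p q h, of_mul_of_pos q r h', of_mul_of_neg p (q.comp r h') h, zero_mul']
  · rw [of_mul_of_neg p q h, of_mul_of_neg q r h', mul_zero', zero_mul']

theorem mul_assoc' (x y z : Q.PathAlgebra) : x * y * z = x * (y * z) := by
  induction x using induction with
  | h0 => simp only [zero_mul']
  | hadd a b ha hb => simp only [add_mul', ha, hb]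
  | hof c p =>
  induction y using induction with
  | h0 => simp only [zero_mul', mul_zero']
  | hadd a b ha hb => simp only [add_mul', mul_add', ha, hb]
  | hof d q =>
  induction z using induction with
  | h0 => simp only [mul_zero']
  | hadd a b ha hb => simp only [mul_add', ha, hb]
  | hof f r => simp only [smul_mul', mul_smul', of_mul_assoc]

variable [Fintype I]

instance : One Q.PathAlgebra := ⟨∑ i, e Q i⟩

theorem one_def : (1 : Q.PathAlgebra) = ∑ i, e Q i := rfl

theorem one_mul' (x : Q.PathAlgebra) : 1 * x = x := by
  induction x using induction with
  | h0 => exact mul_zero' _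
  | hadd a b ha hb => rw [mul_add', ha, hb]
  | hof c p =>
    have h : (1 : Q.PathAlgebra) * of p = ∑ i, e Q i * of p := by
      rw [one_def, mul_def, map_sum, LinearMap.sum_apply]; rfl
    rw [mul_smul', h]
    simp [e_mul_of]

theorem mul_one' (x : Q.PathAlgebra) : x * 1 = x := by
  induction x using induction with
  | h0 => exact zero_mul' _
  | hadd a b ha hb => rw [add_mul', ha, hb]
  | hof c p =>
    have h : of p * (1 : Q.PathAlgebra) = ∑ i, of p * e Q i := by
      rw [one_def, mul_def, map_sum]; rfl
    rw [smul_mul', h]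
    simp [of_mul_e]

instance : Ring Q.PathAlgebra :=
  { (inferInstance : AddCommGroup Q.PathAlgebra) with
    mul := (· * ·)
    one := 1
    left_distrib := mul_add'
    right_distrib := add_mul'
    zero_mul := zero_mul'
    mul_zero := mul_zero'
    mul_assoc := mul_assoc'
    one_mul := one_mul'
    mul_one := mul_one' }

instance : Algebra ℂ Q.PathAlgebra := Algebra.ofModule smul_mul' mul_smul'

/-- The arrows as elements of the path algebra. -/
def arrow (Q : ArrowQuiver I E) (x : E) : Q.PathAlgebra := of (Path.ofArrow Q x)

end PathAlgebra

open PathAlgebra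

/-- The double quiver: `Sum.inl a` is the arrow `a`, and `Sum.inr a` the dual arrow `a*`. -/
def double (Q : ArrowQuiver I E) : ArrowQuiver I (E ⊕ E) where
  head := Sum.elim Q.head Q.tail
  tail := Sum.elim Q.tail Q.head

/-- The number of dual arrows in a word of arrows of the double quiver. -/
def numDual (w : List (E ⊕ E)) : ℕ := w.countP Sum.isRight

theorem numDual_append (u w : List (E ⊕ E)) : numDual (u ++ w) = numDual u + numDual w :=
  List.countP_append

/-- The subspace of `ℂQ̄` spanned by the paths with exactly `r` dual arrows. -/
def grade (Q : ArrowQuiver I E) (r : ℕ) : Submodule ℂ Q.double.PathAlgebra :=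
  Submodule.span ℂ {x | ∃ p : Q.double.Path, numDual p.word = r ∧ x = of p}

variable [Fintype I] [DecidableEq I]

/-- The linear span of all `P R - (-1)^(pr) R P`, for `P`, `R` homogeneous of degrees `p`, `r`. -/
def superCommutators (Q : ArrowQuiver I E) : Submodule ℂ Q.double.PathAlgebra :=
  Submodule.span ℂ {x | ∃ p r : ℕ, ∃ P ∈ Q.grade p, ∃ R ∈ Q.grade r,
    x = P * R - (-1 : ℂ) ^ (p * r) • (R * P)}

/-- The space of noncommutative polyvector fields (necklaces): the quotient of the vector space
`ℂQ̄` by the relations `P R = (-1)^(pr) R P`. -/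
abbrev Necklace (Q : ArrowQuiver I E) : Type (max u v) :=
  Q.double.PathAlgebra ⧸ Q.superCommutators

/-- The subspace of necklaces of degree `r`. -/
def necklaceGrade (Q : ArrowQuiver I E) (r : ℕ) : Submodule ℂ Q.Necklace :=
  (Q.grade r).map Q.superCommutators.mkQ

/-- A linear map satisfying the relations on paths satisfies them everywhere. -/
theorem superCommutators_le_ker {Q : ArrowQuiver I E} {M : Type*} [AddCommGroup M] [Module ℂ M]
    (f : Q.double.PathAlgebra →ₗ[ℂ] M)
    (hf : ∀ p q : Q.double.Path,
      f (of p * of q) = (-1 : ℂ) ^ (numDual p.word * numDual q.word) • f (of q * of p)) :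
    Q.superCommutators ≤ LinearMap.ker f := by
  refine Submodule.span_le.2 ?_
  rintro _ ⟨p, r, P, hP, R, hR, rfl⟩
  suffices h : f (P * R) = (-1 : ℂ) ^ (p * r) • f (R * P) by
    simp [LinearMap.mem_ker, h]
  induction hP using Submodule.span_induction with
  | zero => simp
  | add x y _ _ hx hy => simp [add_mul, mul_add, hx, hy]
  | smul c x _ hx => simp [hx, smul_comm c]
  | mem x hx =>
    obtain ⟨p', rfl, rfl⟩ := hx
    induction hR using Submodule.span_induction with
    | zero => simp
    | add x y _ _ hx hy => simp [add_mul, mul_add, hx, hy]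
    | smul c x _ hx => simp [hx, smul_comm c]
    | mem x hx =>
      obtain ⟨q', rfl, rfl⟩ := hx
      exact hf p' q'

/-- A map on paths that respects rotation of closed paths, extended by zero to the paths that are
not closed, satisfies the relations. -/
theorem closed_rotation {Q : ArrowQuiver I E} {M : Type*} [AddCommGroup M] [Module ℂ M]
    (g : Q.double.Path → M)
    (hg : ∀ (p q : Q.double.Path) (h : p.src = q.tgt) (h' : q.src = p.tgt),
      g (p.comp q h) = (-1 : ℂ) ^ (numDual p.word * numDual q.word) • g (q.comp p h')) :
    Q.superCommutators ≤ LinearMap.ker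
      (lift fun p : Q.double.Path => if p.tgt = p.src then g p else 0) := by
  refine superCommutators_le_ker _ fun p q => ?_
  by_cases h : p.src = q.tgt <;> by_cases h' : q.src = p.tgt
  · rw [of_mul_of_pos p q h, of_mul_of_pos q p h', lift_of, lift_of,
      if_pos (show (p.comp q h).tgt = (p.comp q h).src from h'.symm),
      if_pos (show (q.comp p h').tgt = (q.comp p h').src from h.symm)]
    exact hg p q h h'
  · rw [of_mul_of_pos p q h, of_mul_of_neg q p h', lift_of]
    simp [Path.comp, Ne.symm h']
  · rw [of_mul_of_neg p q h, of_mul_of_pos q p h', lift_of]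
    simp [Path.comp, Ne.symm h]
  · rw [of_mul_of_neg p q h, of_mul_of_neg q p h']
    simp

variable [DecidableEq E]

/-- The sum, over the positions `k` with `xₖ = c`, of
`(-1)^(λₖ μₖ) xₖ₊₁ ⋯ xₙ x₁ ⋯ xₖ₋₁`, where `λₖ` is the number of dual arrows among
`xₖ₊₁, …, xₙ` and `μₖ` the number of dual arrows among `x₁, …, xₖ`. The factor
`e_{t(c)}` only matters for the empty word, which stands for the trivial path at `t(c)`.
(In the code positions are counted from `0`.) -/
def wordDeriv (Q : ArrowQuiver I E) (c : E ⊕ E) (w : List (E ⊕ E)) : Q.double.PathAlgebra :=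
  ∑ k ∈ Finset.range w.length, if w[k]? = some c then
    (-1 : ℂ) ^ (numDual (w.drop (k + 1)) * numDual (w.take (k + 1))) •
      (e Q.double (Q.double.tail c) *
        ((w.drop (k + 1) ++ w.take k).map (arrow Q.double)).prod)
  else 0

theorem wordDeriv_rotate (Q : ArrowQuiver I E) (c : E ⊕ E) (u w : List (E ⊕ E)) :
    Q.wordDeriv c (u ++ w) = (-1 : ℂ) ^ (numDual u * numDual w) • Q.wordDeriv c (w ++ u) := by
  have key : ∀ (u w : List (E ⊕ E)), ∀ k < u.length,
      (if (u ++ w)[k]? = some c then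
        (-1 : ℂ) ^ (numDual ((u ++ w).drop (k + 1)) * numDual ((u ++ w).take (k + 1))) •
          (e Q.double (Q.double.tail c) *
            (((u ++ w).drop (k + 1) ++ (u ++ w).take k).map (arrow Q.double)).prod)
        else 0) =
      (-1 : ℂ) ^ (numDual u * numDual w) •
      (if (w ++ u)[w.length + k]? = some c then
        (-1 : ℂ) ^ (numDual ((w ++ u).drop (w.length + k + 1)) *
            numDual ((w ++ u).take (w.length + k + 1))) •
          (e Q.double (Q.double.tail c) *
            (((w ++ u).drop (w.length + k + 1) ++ (w ++ u).take (w.length + k)).map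
              (arrow Q.double)).prod)
        else 0) := by
    intro u w k hk
    have e1 : (u ++ w)[k]? = u[k]? := List.getElem?_append_left hk
    have e2 : (w ++ u)[w.length + k]? = u[k]? := by
      rw [List.getElem?_append_right (by omega)]; congr 1; omega
    have e3 : (u ++ w).drop (k + 1) = u.drop (k + 1) ++ w :=
      List.drop_append_of_le_length (by omega)
    have e4 : (u ++ w).take (k + 1) = u.take (k + 1) := List.take_append_of_le_length (by omega)
    have e5 : (u ++ w).take k = u.take k := List.take_append_of_le_length (by omega)
    have e6 : (w ++ u).drop (w.length + k + 1) = u.drop (k + 1) := by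
      rw [add_assoc, List.drop_append]; simp
    have e7 : (w ++ u).take (w.length + k + 1) = w ++ u.take (k + 1) := by
      rw [add_assoc, List.take_append]; simp
    have e8 : (w ++ u).take (w.length + k) = w ++ u.take k := by
      rw [List.take_append]; simp
    have e9 : numDual u = numDual (u.take (k + 1)) + numDual (u.drop (k + 1)) := by
      rw [← numDual_append, List.take_append_drop]
    rw [e1, e2, e3, e4, e5, e6, e7, e8, e9]
    split_ifs
    · rw [smul_smul, List.append_assoc]
      congr 1
      rw [numDual_append, numDual_append, ← pow_add]
      refine neg_one_pow_congr ?_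
      simp only [Nat.even_add, Nat.even_mul]
      tauto
    · simp
  unfold wordDeriv
  rw [List.length_append, List.length_append, Finset.sum_range_add, Finset.sum_range_add,
    add_comm, smul_add]
  congr 1
  · rw [Finset.smul_sum]
    refine Finset.sum_congr rfl fun k hk => ?_
    have h := key w u k (Finset.mem_range.1 hk)
    rw [h, smul_smul, ← pow_add, mul_comm (numDual w), ← two_mul, pow_mul]
    simp
  · rw [Finset.smul_sum]
    refine Finset.sum_congr rfl fun k hk => ?_
    exact key u w k (Finset.mem_range.1 hk)

/-- The directional superderivative `D_c` on necklaces, for an arrow `c` of the double quiver.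
(Paths that are not closed are zero as necklaces.) -/
def superDeriv (Q : ArrowQuiver I E) (c : E ⊕ E) : Q.Necklace →ₗ[ℂ] Q.double.PathAlgebra :=
  Q.superCommutators.liftQ
    (lift fun p : Q.double.Path => if p.tgt = p.src then Q.wordDeriv c p.word else 0)
    (closed_rotation (fun p => Q.wordDeriv c p.word) fun p q _ _ =>
      Q.wordDeriv_rotate c p.word q.word)

variable [Fintype E]

/-- The Schouten bracket of a necklace `γ` of degree `r` and a necklace `δ` of degree `s`. -/
def schouten (Q : ArrowQuiver I E) (r s : ℕ) (γ δ : Q.Necklace) : Q.Necklace :=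
  Q.superCommutators.mkQ (∑ a : E,
    (Q.superDeriv (Sum.inr a) γ * Q.superDeriv (Sum.inl a) δ -
      (-1 : ℂ) ^ (((r : ℤ) - 1) * ((s : ℤ) - 1)) •
        (Q.superDeriv (Sum.inr a) δ * Q.superDeriv (Sum.inl a) γ)))

/-- A Poisson structure on `ℂQ`: a necklace of degree `2` whose Schouten bracket with itself
vanishes. -/
def IsPoisson (Q : ArrowQuiver I E) (P : Q.Necklace) : Prop :=
  P ∈ Q.necklaceGrade 2 ∧ Q.schouten 2 2 P P = 0

/-- Fusing the end points of an arrow `a` with distinct end points `i = t(a)` and `j = h(a)`: the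
vertex `j` is left out, and `i` stands for the fused vertex. -/
def fuse (Q : ArrowQuiver I E) (a : E) (ha : Q.head a ≠ Q.tail a) (v : I) :
    {v : I // v ≠ Q.head a} :=
  if h : v = Q.head a then ⟨Q.tail a, ha.symm⟩ else ⟨v, h⟩

/-- The quiver `Q_a`: `Q` with the arrow `a` contracted. -/
def contract (Q : ArrowQuiver I E) (a : E) (ha : Q.head a ≠ Q.tail a) :
    ArrowQuiver {v : I // v ≠ Q.head a} {b : E // b ≠ a} where
  head b := Q.fuse a ha (Q.head b)
  tail b := Q.fuse a ha (Q.tail b)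

/-- The element that replaces an arrow of the double of `Q`: with `j = h(a)`, the arrow `a` is
replaced by `1`, its dual `a*` by `∑_{t(b) = j} b* b - ∑_{h(b) = j, b ≠ a} b b*`, and all other
arrows are kept. (The first sum leaves out nothing, as `t(a) ≠ j`.) -/
def contractArrow (Q : ArrowQuiver I E) (a : E) (ha : Q.head a ≠ Q.tail a) :
    E ⊕ E → (Q.contract a ha).double.PathAlgebra
  | Sum.inl b => if h : b = a then 1 else arrow (Q.contract a ha).double (Sum.inl ⟨b, h⟩)
  | Sum.inr b => if h : b = a then
      (∑ c ∈ Finset.univ.filter (fun c : {b : E // b ≠ a} => Q.tail c = Q.head a),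
        arrow (Q.contract a ha).double (Sum.inr c) * arrow (Q.contract a ha).double (Sum.inl c)) -
      (∑ c ∈ Finset.univ.filter (fun c : {b : E // b ≠ a} => Q.head c = Q.head a),
        arrow (Q.contract a ha).double (Sum.inl c) * arrow (Q.contract a ha).double (Sum.inr c))
    else arrow (Q.contract a ha).double (Sum.inr ⟨b, h⟩)

/-- The substitution, on a path `x₁ ⋯ xₙ` with head `i`. -/
def contractPath (Q : ArrowQuiver I E) (a : E) (ha : Q.head a ≠ Q.tail a) (p : Q.double.Path) :
    (Q.contract a ha).double.PathAlgebra :=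
  e (Q.contract a ha).double (Q.fuse a ha p.tgt) * (p.word.map (Q.contractArrow a ha)).prod

theorem e_mul_arrow {Q : ArrowQuiver I E} (x : E) {i : I} (h : i = Q.head x) :
    e Q i * arrow Q x = arrow Q x := by
  exact (e_mul_of i (Path.ofArrow Q x)).trans (if_pos h)

theorem arrow_mul_e {Q : ArrowQuiver I E} (x : E) {i : I} (h : Q.tail x = i) :
    arrow Q x * e Q i = arrow Q x := by
  exact (of_mul_e i (Path.ofArrow Q x)).trans (if_pos h)

theorem e_mul_e {Q : ArrowQuiver I E} (i : I) : e Q i * e Q i = e Q i := by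
  exact (e_mul_of i (Path.triv Q i)).trans (if_pos rfl)

theorem fuse_head (Q : ArrowQuiver I E) (a : E) (ha : Q.head a ≠ Q.tail a) :
    Q.fuse a ha (Q.head a) = Q.fuse a ha (Q.tail a) := by
  simp [fuse, ha.symm]

theorem e_mul_contractArrow (Q : ArrowQuiver I E) (a : E) (ha : Q.head a ≠ Q.tail a)
    (x : E ⊕ E) :
    e (Q.contract a ha).double (Q.fuse a ha (Q.double.head x)) * Q.contractArrow a ha x =
      Q.contractArrow a ha x * e (Q.contract a ha).double (Q.fuse a ha (Q.double.tail x)) := by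
  rcases x with b | b
  · by_cases h : b = a
    · subst h
      simp only [contractArrow, dif_pos, mul_one, one_mul]
      exact congrArg _ (Q.fuse_head b ha)
    · simp only [contractArrow, dif_neg h]
      rw [e_mul_arrow, arrow_mul_e] <;> rfl
  · by_cases h : b = a
    · subst h
      have h1 : Q.fuse b ha (Q.double.head (Sum.inr b)) = Q.fuse b ha (Q.head b) :=
        (Q.fuse_head b ha).symm
      have h2 : Q.fuse b ha (Q.double.tail (Sum.inr b)) = Q.fuse b ha (Q.head b) := rfl
      simp only [contractArrow, dif_pos, h1, h2, mul_sub, sub_mul, Finset.mul_sum, Finset.sum_mul]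
      congr 1
      · refine Finset.sum_congr rfl fun c hc => ?_
        have hc : Q.tail c = Q.head b := by simpa using hc
        rw [← mul_assoc, mul_assoc _ _ (e _ _), e_mul_arrow, arrow_mul_e] <;>
          simp [double, contract, hc]
      · refine Finset.sum_congr rfl fun c hc => ?_
        have hc : Q.head c = Q.head b := by simpa using hc
        rw [← mul_assoc, mul_assoc _ _ (e _ _), e_mul_arrow, arrow_mul_e] <;>
          simp [double, contract, hc]
    · simp only [contractArrow, dif_neg h]
      rw [e_mul_arrow, arrow_mul_e] <;> rfl

theorem e_mul_contractWord (Q : ArrowQuiver I E) (a : E) (ha : Q.head a ≠ Q.tail a)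
    (w : List (E ⊕ E)) (i j : I) (h : Q.double.IsPath i w j) :
    e (Q.contract a ha).double (Q.fuse a ha i) * (w.map (Q.contractArrow a ha)).prod =
      (w.map (Q.contractArrow a ha)).prod * e (Q.contract a ha).double (Q.fuse a ha j) := by
  induction w generalizing i with
  | nil => obtain rfl : i = j := h; simp
  | cons x w ih =>
    obtain ⟨rfl, h⟩ := h
    rw [List.map_cons, List.prod_cons, ← mul_assoc, e_mul_contractArrow, mul_assoc, ih _ h,
      mul_assoc]

theorem contractPath_comp (Q : ArrowQuiver I E) (a : E) (ha : Q.head a ≠ Q.tail a)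
    (p q : Q.double.Path) (h : p.src = q.tgt) :
    Q.contractPath a ha (p.comp q h) = Q.contractPath a ha p * Q.contractPath a ha q := by
  simp only [contractPath, Path.comp, List.map_append, List.prod_append]
  rw [e_mul_contractWord Q a ha p.word p.tgt p.src p.isPath, h]
  rw [mul_assoc _ (e _ _) (e _ _ * _), ← mul_assoc (e _ _) (e _ _), e_mul_e, ← mul_assoc,
    e_mul_contractWord Q a ha p.word p.tgt p.src p.isPath, h, mul_assoc]

theorem grade_mul {Q : ArrowQuiver I E} {r s : ℕ} {x y : Q.double.PathAlgebra}
    (hx : x ∈ Q.grade r) (hy : y ∈ Q.grade s) : x * y ∈ Q.grade (r + s) := by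
  induction hx using Submodule.span_induction with
  | zero => simp
  | add x x' _ _ hx hx' => rw [add_mul]; exact add_mem hx hx'
  | smul c x _ hx => rw [smul_mul_assoc]; exact Submodule.smul_mem _ _ hx
  | mem x hx =>
    obtain ⟨p, rfl, rfl⟩ := hx
    induction hy using Submodule.span_induction with
    | zero => simp
    | add x x' _ _ hx hx' => rw [mul_add]; exact add_mem hx hx'
    | smul c x _ hx => rw [mul_smul_comm]; exact Submodule.smul_mem _ _ hx
    | mem x hx =>
      obtain ⟨q, rfl, rfl⟩ := hx
      by_cases h : p.src = q.tgt
      · rw [of_mul_of_pos p q h]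
        exact Submodule.subset_span ⟨_, numDual_append _ _, rfl⟩
      · rw [of_mul_of_neg p q h]
        exact zero_mem _

theorem e_mem_grade (Q : ArrowQuiver I E) (i : I) : e Q.double i ∈ Q.grade 0 :=
  Submodule.subset_span ⟨_, rfl, rfl⟩

theorem arrow_inl_mem_grade (Q : ArrowQuiver I E) (b : E) :
    arrow Q.double (Sum.inl b) ∈ Q.grade 0 :=
  Submodule.subset_span ⟨_, rfl, rfl⟩

theorem arrow_inr_mem_grade (Q : ArrowQuiver I E) (b : E) :
    arrow Q.double (Sum.inr b) ∈ Q.grade 1 :=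
  Submodule.subset_span ⟨_, rfl, rfl⟩

theorem one_mem_grade (Q : ArrowQuiver I E) : (1 : Q.double.PathAlgebra) ∈ Q.grade 0 := by
  rw [one_def]
  exact sum_mem fun i _ => Q.e_mem_grade i

theorem contractArrow_mem_grade (Q : ArrowQuiver I E) (a : E) (ha : Q.head a ≠ Q.tail a)
    (x : E ⊕ E) : Q.contractArrow a ha x ∈ (Q.contract a ha).grade (numDual [x]) := by
  rcases x with b | b
  · by_cases h : b = a
    · simp only [contractArrow, dif_pos h]; exact one_mem_grade _
    · simp only [contractArrow, dif_neg h]; exact arrow_inl_mem_grade _ _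
  · by_cases h : b = a
    · simp only [contractArrow, dif_pos h]
      refine sub_mem (sum_mem fun c _ => ?_) (sum_mem fun c _ => ?_)
      · exact grade_mul (r := 1) (s := 0) (arrow_inr_mem_grade _ _) (arrow_inl_mem_grade _ _)
      · exact grade_mul (r := 0) (s := 1) (arrow_inl_mem_grade _ _) (arrow_inr_mem_grade _ _)
    · simp only [contractArrow, dif_neg h]; exact arrow_inr_mem_grade _ _

theorem contractPath_mem_grade (Q : ArrowQuiver I E) (a : E) (ha : Q.head a ≠ Q.tail a)
    (p : Q.double.Path) :
    Q.contractPath a ha p ∈ (Q.contract a ha).grade (numDual p.word) := by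
  have key : ∀ w : List (E ⊕ E),
      (w.map (Q.contractArrow a ha)).prod ∈ (Q.contract a ha).grade (numDual w) := by
    intro w
    induction w with
    | nil => exact one_mem_grade _
    | cons x w ih =>
      rw [List.map_cons, List.prod_cons, show numDual (x :: w) = numDual [x] + numDual w from
        numDual_append [x] w]
      exact grade_mul (Q.contractArrow_mem_grade a ha x) ih
  have h := grade_mul ((Q.contract a ha).e_mem_grade (Q.fuse a ha p.tgt)) (key p.word)
  rwa [zero_add] at h

/-- The map `Π ↦ Π_a` from necklaces of `Q` to necklaces of `Q_a`: write `Π` in terms of closed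
paths and substitute. Paths of the double of `Q` that are not closed are zero as necklaces and
have to be sent to zero here, although they may become closed in `Q_a`. -/
def contractNecklace (Q : ArrowQuiver I E) (a : E) (ha : Q.head a ≠ Q.tail a) :
    Q.Necklace →ₗ[ℂ] (Q.contract a ha).Necklace :=
  Q.superCommutators.liftQ
    (lift fun p : Q.double.Path => if p.tgt = p.src then
      (Q.contract a ha).superCommutators.mkQ (Q.contractPath a ha p) else 0)
    (closed_rotation _ fun p q h h' => by
      rw [contractPath_comp, contractPath_comp, ← map_smul, ← sub_eq_zero, ← map_sub]
      refine (Submodule.Quotient.mk_eq_zero _).2 (Submodule.subset_span ?_)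
      exact ⟨_, _, _, Q.contractPath_mem_grade a ha p, _, Q.contractPath_mem_grade a ha q, rfl⟩)

end ArrowQuiver

end

/-!
Contracting `a` is a Hamiltonian reduction at the vertex `j = h(a)`: the group at `j` acts on `a`
simply transitively, so `a = 1` is a slice, and the element substituted for `a*` solves the moment
map equation at `j` on this slice. By the chain rule, `D_c (γ_a)` is the image of `D_c γ` up to a
correction involving `D_{a*} γ`. On the other hand every `γ` is invariant: the supercommutators
`[D_x γ, x]` add up to zero, and for `a = 1` the component of this identity at `j` expresses
`D_a γ` through the derivatives along the remaining arrows. This is why the corrections to the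
bracket of `γ_a` and `δ_a` add up to the image of the summand for `a` in the bracket of `γ` and
`δ`, the only summand missing over `Q_a`, and `γ ↦ γ_a` commutes with the brackets.
-/

noncomputable section

namespace ArrowQuiver

open PathAlgebra

variable {I E : Type*}

theorem Path.induction {Q : ArrowQuiver I E} {motive : Q.Path → Prop}
    (triv : ∀ i, motive (Path.triv Q i))
    (cons : ∀ x p (h : (Path.ofArrow Q x).src = p.tgt), motive p →
      motive ((Path.ofArrow Q x).comp p h))
    (p : Q.Path) : motive p := by
  obtain ⟨i, w, j, hw⟩ := p
  induction w generalizing i with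
  | nil =>
    obtain rfl : i = j := hw
    exact triv i
  | cons x w ih =>
    obtain ⟨rfl, hw⟩ := hw
    exact cons x ⟨_, w, j, hw⟩ rfl (ih _ hw)

theorem IsPath.split {Q : ArrowQuiver I E} {i j : I} {w : List E} (h : Q.IsPath i w j) {k : ℕ}
    {c : E} (hk : w[k]? = some c) :
    Q.IsPath i (w.take k) (Q.head c) ∧ Q.IsPath (Q.tail c) (w.drop (k + 1)) j := by
  induction w generalizing i k with
  | nil => simp at hk
  | cons x w ih =>
    cases k with
    | zero =>
      obtain rfl : x = c := by simpa using hk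
      exact h
    | succ k =>
      have := ih h.2 (k := k) (by simpa using hk)
      exact ⟨⟨h.1, this.1⟩, this.2⟩

theorem numDual_cons (x : E ⊕ E) (w : List (E ⊕ E)) :
    numDual (x :: w) = numDual [x] + numDual w := numDual_append [x] w

@[simp] theorem numDual_singleton_inl (b : E) : numDual [(Sum.inl b : E ⊕ E)] = 0 := rfl

@[simp] theorem numDual_singleton_inr (b : E) : numDual [(Sum.inr b : E ⊕ E)] = 1 := rfl

theorem neg_one_pow_mul_self {R : Type*} [Monoid R] [HasDistribNeg R] (n : ℕ) :
    (-1 : R) ^ n * (-1) ^ n = 1 := by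
  rw [← pow_add, (Even.add_self n).neg_one_pow]

section PathAlgebra

variable {Q : ArrowQuiver I E}

theorem of_triv (i : I) : of (Path.triv Q i) = e Q i := rfl

variable [DecidableEq I]

theorem of_comp (p q : Q.Path) (h : p.src = q.tgt) : of (p.comp q h) = of p * of q :=
  (of_mul_of_pos p q h).symm

theorem of_ofArrow_comp (x : E) (p : Q.Path) (h : (Path.ofArrow Q x).src = p.tgt) :
    of ((Path.ofArrow Q x).comp p h) = arrow Q x * of p :=
  of_comp _ _ h

theorem e_tgt_mul_of (p : Q.Path) : e Q p.tgt * of p = of p :=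
  (e_mul_of _ p).trans (if_pos rfl)

theorem of_mul_e_src (p : Q.Path) : of p * e Q p.src = of p :=
  (of_mul_e _ p).trans (if_pos rfl)

theorem e_mul_e_self (Q : ArrowQuiver I E) (i : I) : e Q i * e Q i = e Q i :=
  e_tgt_mul_of (Path.triv Q i)

theorem e_mul_e_of_ne {i j : I} (h : i ≠ j) : e Q i * e Q j = 0 :=
  of_mul_of_neg _ _ h

variable [Fintype I]

/-- The space `e_i ℂQ e_j`, spanned by the paths from `j` to `i`. -/
def corner (Q : ArrowQuiver I E) (i j : I) : Submodule ℂ Q.PathAlgebra where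
  carrier := {x | e Q i * x = x ∧ x * e Q j = x}
  zero_mem' := ⟨mul_zero _, zero_mul _⟩
  add_mem' hx hy := ⟨by rw [mul_add, hx.1, hy.1], by rw [add_mul, hx.2, hy.2]⟩
  smul_mem' t x hx := ⟨by rw [mul_smul_comm, hx.1], by rw [smul_mul_assoc, hx.2]⟩

theorem of_mem_corner (p : Q.Path) : of p ∈ Q.corner p.tgt p.src :=
  ⟨e_tgt_mul_of p, of_mul_e_src p⟩

theorem e_mem_corner (Q : ArrowQuiver I E) (i : I) : e Q i ∈ Q.corner i i :=
  of_mem_corner (Path.triv Q i)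

theorem arrow_mem_corner (Q : ArrowQuiver I E) (x : E) :
    arrow Q x ∈ Q.corner (Q.head x) (Q.tail x) :=
  of_mem_corner (Path.ofArrow Q x)

theorem mul_mem_corner {i j k l : I} {x y : Q.PathAlgebra} (hx : x ∈ Q.corner i j)
    (hy : y ∈ Q.corner k l) : x * y ∈ Q.corner i l :=
  ⟨by rw [← mul_assoc, hx.1], by rw [mul_assoc, hy.2]⟩

theorem e_mul_of_mem_corner {i j k : I} {x : Q.PathAlgebra} (hx : x ∈ Q.corner j k) :
    e Q i * x = if i = j then x else 0 := by
  split_ifs with h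
  · exact h ▸ hx.1
  · rw [← hx.1, ← mul_assoc, e_mul_e_of_ne h, zero_mul]

theorem e_mul_mul_e_mem_corner (i j : I) (x : Q.PathAlgebra) :
    e Q i * x * e Q j ∈ Q.corner i j :=
  ⟨by rw [← mul_assoc, ← mul_assoc, e_mul_e_self], by rw [mul_assoc, e_mul_e_self]⟩

theorem e_mul_prod_map_arrow {i j : I} {w : List E} (h : Q.IsPath i w j) :
    e Q i * (w.map (arrow Q)).prod = of ⟨i, w, j, h⟩ := by
  induction w generalizing i with
  | nil =>
    obtain rfl : i = j := h
    exact mul_one _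
  | cons x w ih =>
    obtain ⟨rfl, h⟩ := h
    refine Eq.trans ?_ (of_ofArrow_comp x ⟨_, w, j, h⟩ rfl).symm
    rw [← ih h, List.map_cons, List.prod_cons, ← mul_assoc, ← mul_assoc,
      (arrow_mem_corner Q x).1, (arrow_mem_corner Q x).2]

theorem prod_map_arrow_mul_e {i j : I} {w : List E} (h : Q.IsPath i w j) :
    (w.map (arrow Q)).prod * e Q j = of ⟨i, w, j, h⟩ := by
  induction w generalizing i with
  | nil =>
    obtain rfl : i = j := h
    exact one_mul _
  | cons x w ih =>
    obtain ⟨rfl, h⟩ := h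
    refine Eq.trans ?_ (of_ofArrow_comp x ⟨_, w, j, h⟩ rfl).symm
    rw [← ih h, List.map_cons, List.prod_cons, mul_assoc]

end PathAlgebra

section Degree

theorem of_mem_grade (Q : ArrowQuiver I E) (p : Q.double.Path) :
    of p ∈ Q.grade (numDual p.word) :=
  Submodule.subset_span ⟨p, rfl, rfl⟩

/-- The span of the paths whose number of dual arrows has the parity of `r`. All signs depend on
degrees modulo two only; working with parities avoids the degree `r - 1` of a derivative of a
necklace of degree `r`. -/
def parityGrade (Q : ArrowQuiver I E) (r : ℕ) : Submodule ℂ Q.double.PathAlgebra :=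
  Submodule.span ℂ {x | ∃ p : Q.double.Path, numDual p.word ≡ r [MOD 2] ∧ x = of p}

theorem of_mem_parityGrade {Q : ArrowQuiver I E} {p : Q.double.Path} {r : ℕ}
    (h : numDual p.word ≡ r [MOD 2]) : of p ∈ Q.parityGrade r :=
  Submodule.subset_span ⟨p, h, rfl⟩

theorem parityGrade_congr (Q : ArrowQuiver I E) {r s : ℕ} (h : r ≡ s [MOD 2]) :
    Q.parityGrade r = Q.parityGrade s := by
  have h_iff (n : ℕ) : n ≡ r [MOD 2] ↔ n ≡ s [MOD 2] := ⟨(·.trans h), (·.trans h.symm)⟩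
  simp only [parityGrade, h_iff]

theorem grade_le_parityGrade (Q : ArrowQuiver I E) (r : ℕ) : Q.grade r ≤ Q.parityGrade r :=
  Submodule.span_mono fun _ ⟨p, hp, hx⟩ => ⟨p, hp ▸ .refl _, hx⟩

theorem e_mem_parityGrade (Q : ArrowQuiver I E) (i : I) : e Q.double i ∈ Q.parityGrade 0 :=
  of_mem_parityGrade (p := Path.triv Q.double i) (.refl _)

theorem arrow_mem_parityGrade (Q : ArrowQuiver I E) (x : E ⊕ E) :
    arrow Q.double x ∈ Q.parityGrade (numDual [x]) :=
  of_mem_parityGrade (p := Path.ofArrow Q.double x) (.refl _)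

theorem one_mem_parityGrade [Fintype I] (Q : ArrowQuiver I E) :
    (1 : Q.double.PathAlgebra) ∈ Q.parityGrade 0 :=
  sum_mem fun i _ => Q.e_mem_parityGrade i

variable [DecidableEq I]

theorem mul_mem_parityGrade {Q : ArrowQuiver I E} {r s : ℕ} {x y : Q.double.PathAlgebra}
    (hx : x ∈ Q.parityGrade r) (hy : y ∈ Q.parityGrade s) : x * y ∈ Q.parityGrade (r + s) := by
  have hxy := Submodule.apply_mem_map₂ (mulMap Q.double) hx hy
  rw [parityGrade, parityGrade, Submodule.map₂_span_span] at hxy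
  refine Submodule.span_le.2 ?_ hxy
  rintro _ ⟨_, ⟨p, hp, rfl⟩, _, ⟨q, hq, rfl⟩, rfl⟩
  change of p * of q ∈ Q.parityGrade (r + s)
  by_cases h : p.src = q.tgt
  · rw [of_mul_of_pos p q h]
    exact of_mem_parityGrade (by rw [Path.comp, numDual_append]; exact hp.add hq)
  · rw [of_mul_of_neg p q h]
    exact zero_mem _

variable [Fintype I]

theorem mkQ_of_mul_of_comm (Q : ArrowQuiver I E) (p q : Q.double.Path) :
    Q.superCommutators.mkQ (of p * of q) =
      (-1 : ℂ) ^ (numDual p.word * numDual q.word) • Q.superCommutators.mkQ (of q * of p) := by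
  rw [← map_smul, ← sub_eq_zero, ← map_sub]
  exact (Submodule.Quotient.mk_eq_zero _).2 (Submodule.subset_span
    ⟨_, _, of p, Q.of_mem_grade p, of q, Q.of_mem_grade q, rfl⟩)

theorem mkQ_mul_comm {Q : ArrowQuiver I E} {r s : ℕ} {x y : Q.double.PathAlgebra}
    (hx : x ∈ Q.parityGrade r) (hy : y ∈ Q.parityGrade s) :
    Q.superCommutators.mkQ (x * y) = (-1 : ℂ) ^ (r * s) • Q.superCommutators.mkQ (y * x) := by
  induction hx, hy using Submodule.span_induction₂ with
  | mem_mem x y hx hy =>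
    obtain ⟨p, hp, rfl⟩ := hx
    obtain ⟨q, hq, rfl⟩ := hy
    have h_even : Even (numDual p.word * numDual q.word) ↔ Even (r * s) := by
      rw [Nat.even_iff, Nat.even_iff, hp.mul hq]
    rw [mkQ_of_mul_of_comm, neg_one_pow_congr h_even]
  | zero_left y _ => simp only [zero_mul, mul_zero, map_zero, smul_zero]
  | zero_right x _ => simp only [zero_mul, mul_zero, map_zero, smul_zero]
  | add_left x y z _ _ _ hx hy => simp only [add_mul, mul_add, map_add, hx, hy, smul_add]
  | add_right x y z _ _ _ hx hy => simp only [add_mul, mul_add, map_add, hx, hy, smul_add]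
  | smul_left t x y _ _ h => simp only [smul_mul_assoc, mul_smul_comm, map_smul, h, smul_comm t]
  | smul_right t x y _ _ h => simp only [smul_mul_assoc, mul_smul_comm, map_smul, h, smul_comm t]

theorem mkQ_mul_comm_of_even {Q : ArrowQuiver I E} {s : ℕ} {x y : Q.double.PathAlgebra}
    (hx : x ∈ Q.parityGrade 0) (hy : y ∈ Q.parityGrade s) :
    Q.superCommutators.mkQ (x * y) = Q.superCommutators.mkQ (y * x) := by
  rw [mkQ_mul_comm hx hy, zero_mul, pow_zero, one_smul]

theorem mkQ_mul_comm_of_succ {Q : ArrowQuiver I E} {r s : ℕ} {x y : Q.double.PathAlgebra}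
    (hx : x ∈ Q.parityGrade (r + 1)) (hy : y ∈ Q.parityGrade s) :
    Q.superCommutators.mkQ (x * y) = ((-1 : ℂ) ^ ((r + 1) * (s + 1)) * (-1) ^ (r + 1)) •
      Q.superCommutators.mkQ (y * x) := by
  rw [mkQ_mul_comm hx hy, ← pow_add]
  congr 1
  refine neg_one_pow_congr ?_
  simp only [Nat.even_add, Nat.even_mul, Nat.not_even_one]
  tauto

theorem mkQ_of_eq_zero {Q : ArrowQuiver I E} {p : Q.double.Path} (h : p.tgt ≠ p.src) :
    Q.superCommutators.mkQ (of p) = 0 := by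
  rw [← of_mul_e_src p, e, mkQ_of_mul_of_comm, of_mul_of_neg (Path.triv _ _) p h.symm,
    map_zero, smul_zero]

theorem necklaceGrade_le {Q : ArrowQuiver I E} {r : ℕ} {N : Submodule ℂ Q.Necklace}
    (h : ∀ p : Q.double.Path, p.tgt = p.src → numDual p.word = r →
      Q.superCommutators.mkQ (of p) ∈ N) : Q.necklaceGrade r ≤ N := by
  refine Submodule.map_le_iff_le_comap.2 (Submodule.span_le.2 ?_)
  rintro _ ⟨p, hr, rfl⟩
  by_cases hp : p.tgt = p.src
  · exact h p hp hr
  · simpa only [SetLike.mem_coe, Submodule.mem_comap, mkQ_of_eq_zero hp] using N.zero_mem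

theorem eq_of_mem_necklaceGrade {Q : ArrowQuiver I E} {r : ℕ} {M : Type*} [AddCommGroup M]
    [Module ℂ M] {f g : Q.Necklace →ₗ[ℂ] M}
    (h : ∀ p : Q.double.Path, p.tgt = p.src → numDual p.word = r →
      f (Q.superCommutators.mkQ (of p)) = g (Q.superCommutators.mkQ (of p)))
    {γ : Q.Necklace} (hγ : γ ∈ Q.necklaceGrade r) : f γ = g γ :=
  necklaceGrade_le (N := LinearMap.eqLocus f g) h hγ

end Degree

section Slide

variable [Fintype I] [DecidableEq I] [DecidableEq E] (Q : ArrowQuiver I E) (ε : ℂ) (c : E ⊕ E)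

/-- For a word `w`, the linear map sending `z` to the sum of `ε^(|u|) v z u` over the
factorizations `w = u c v`, where `|u|` is the number of dual arrows in `u`. The idempotents only
matter for empty words `u` and `v`. -/
def wordSlide (w : List (E ⊕ E)) : Q.double.PathAlgebra →ₗ[ℂ] Q.double.PathAlgebra :=
  ∑ k ∈ Finset.range w.length, if w[k]? = some c then
    ε ^ numDual (w.take k) • LinearMap.mulLeftRight ℂ
      (e Q.double (Q.double.tail c) * ((w.drop (k + 1)).map (arrow Q.double)).prod,
        ((w.take k).map (arrow Q.double)).prod * e Q.double (Q.double.head c))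
  else 0

theorem wordSlide_nil : Q.wordSlide ε c [] = 0 := rfl

theorem wordSlide_cons (x : E ⊕ E) (w : List (E ⊕ E)) (z : Q.double.PathAlgebra) :
    Q.wordSlide ε c (x :: w) z =
      (if x = c then e Q.double (Q.double.tail c) * (w.map (arrow Q.double)).prod * z *
        e Q.double (Q.double.head c) else 0) +
      ε ^ numDual [x] • Q.wordSlide ε c w (z * arrow Q.double x) := by
  rw [wordSlide, List.length_cons, Finset.sum_range_succ', LinearMap.add_apply, add_comm]
  congr 1
  · simp only [List.getElem?_cons_zero, Option.some.injEq]
    split_ifs <;> simp [numDual]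
  · simp only [wordSlide, LinearMap.sum_apply, Finset.smul_sum]
    refine Finset.sum_congr rfl fun k _ => ?_
    simp only [List.getElem?_cons_succ, List.take_succ_cons, List.drop_succ_cons, List.map_cons,
      List.prod_cons, numDual_cons x (w.take k)]
    split_ifs <;> simp [pow_add, mul_smul, mul_assoc]

/-- The double derivation of `ℂQ̄` (twisted by powers of `ε`) that singles out the arrow `c`,
with a third element inserted: it sends a path `x` and an element `z` to the sum of
`ε^(|u|) v z u` over the factorizations `x = u c v`. -/
def slide : Q.double.PathAlgebra →ₗ[ℂ] Q.double.PathAlgebra →ₗ[ℂ] Q.double.PathAlgebra :=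
  lift fun p => Q.wordSlide ε c p.word

theorem slide_of (p : Q.double.Path) : Q.slide ε c (of p) = Q.wordSlide ε c p.word := lift_of _ p

@[simp] theorem slide_e (i : I) : Q.slide ε c (e Q.double i) = 0 := Q.slide_of ε c _

theorem slide_arrow (x : E ⊕ E) (z : Q.double.PathAlgebra) :
    Q.slide ε c (arrow Q.double x) z =
      if x = c then e Q.double (Q.double.tail c) * z * e Q.double (Q.double.head c) else 0 := by
  rw [arrow, slide_of, Path.ofArrow, wordSlide_cons, wordSlide_nil]
  simp

theorem slide_arrow_of_mem_corner {x : E ⊕ E} {z : Q.double.PathAlgebra}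
    (hz : z ∈ Q.double.corner (Q.double.tail x) (Q.double.head x)) :
    Q.slide ε c (arrow Q.double x) z = if x = c then z else 0 := by
  rw [slide_arrow]
  refine ite_congr rfl (fun hxc => ?_) fun _ => rfl
  rw [← hxc, hz.1, hz.2]

theorem slide_ofArrow_comp (x : E ⊕ E) (p : Q.double.Path)
    (h : (Path.ofArrow Q.double x).src = p.tgt) (z : Q.double.PathAlgebra) :
    Q.slide ε c (of ((Path.ofArrow Q.double x).comp p h)) z =
      Q.slide ε c (arrow Q.double x) (of p * z) +
        ε ^ numDual [x] • Q.slide ε c (of p) (z * arrow Q.double x) := by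
  rw [slide_of, slide_of, slide_arrow]
  refine (Q.wordSlide_cons ε c x p.word z).trans ?_
  congr 1
  refine ite_congr rfl (fun hx => ?_) fun _ => rfl
  subst hx
  rw [show Q.double.tail x = p.tgt from h, e_mul_prod_map_arrow p.isPath, ← mul_assoc,
    e_tgt_mul_of]

theorem slide_mem_corner (x z : Q.double.PathAlgebra) :
    Q.slide ε c x z ∈ Q.double.corner (Q.double.tail c) (Q.double.head c) := by
  induction x using PathAlgebra.induction with
  | h0 => simp
  | hadd x y hx hy => simpa using add_mem hx hy
  | hof t p =>
    rw [map_smul, LinearMap.smul_apply]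
    refine Submodule.smul_mem _ _ ?_
    induction p using Path.induction generalizing z with
    | triv i => simp [of_triv]
    | cons x p h ih =>
      rw [slide_ofArrow_comp, slide_arrow]
      refine add_mem ?_ (Submodule.smul_mem _ _ (ih _))
      split_ifs
      · exact e_mul_mul_e_mem_corner _ _ _
      · exact zero_mem _

theorem slide_of_mul_e (p : Q.double.Path) (i : I) (z : Q.double.PathAlgebra) :
    Q.slide ε c (of p) (z * e Q.double i) = if i = p.tgt then Q.slide ε c (of p) z else 0 := by
  induction p using Path.induction with
  | triv j =>
    simp [of_triv]
  | cons x p h _ =>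
    change _ = if i = Q.double.head x then _ else _
    rw [slide_ofArrow_comp, slide_ofArrow_comp, mul_assoc z, slide_arrow, slide_arrow]
    by_cases hi : i = Q.double.head x
    · rw [hi, (arrow_mem_corner Q.double x).1, if_pos rfl]
      congr 1
      refine ite_congr rfl (fun hx => ?_) fun _ => rfl
      simp only [hx, mul_assoc, e_mul_e_self]
    · rw [if_neg hi, arrow, ← e_tgt_mul_of (Path.ofArrow Q.double x), ← mul_assoc (e _ i),
        Path.ofArrow, e_mul_e_of_ne hi, zero_mul, mul_zero, map_zero, smul_zero, add_zero]
      refine ite_eq_right_iff.2 fun hx => ?_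
      simp only [mul_assoc, e_mul_e_of_ne (hx ▸ hi), mul_zero]

theorem slide_e_mul (i : I) (y z : Q.double.PathAlgebra) :
    Q.slide ε c (e Q.double i * y) z = Q.slide ε c y (z * e Q.double i) := by
  induction y using PathAlgebra.induction with
  | h0 => simp
  | hadd x y hx hy => simp only [mul_add, map_add, LinearMap.add_apply, hx, hy]
  | hof t p =>
    rw [mul_smul_comm, map_smul, map_smul, LinearMap.smul_apply, LinearMap.smul_apply, e_mul_of,
      slide_of_mul_e]
    split_ifs <;> simp

theorem slide_e_of_mem_corner {i j : I} {x : Q.double.PathAlgebra}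
    (hx : x ∈ Q.double.corner i j) : Q.slide ε c x (e Q.double i) = Q.slide ε c x 1 := by
  rw [← one_mul (e Q.double i), ← slide_e_mul, hx.1]

theorem slide_arrow_mul (x : E ⊕ E) (y z : Q.double.PathAlgebra) :
    Q.slide ε c (arrow Q.double x * y) z =
      Q.slide ε c (arrow Q.double x) (y * z) +
        ε ^ numDual [x] • Q.slide ε c y (z * arrow Q.double x) := by
  induction y using PathAlgebra.induction with
  | h0 => simp
  | hadd y y' hy hy' =>
    simp only [mul_add, add_mul, map_add, LinearMap.add_apply, hy, hy', smul_add]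
    abel
  | hof t p =>
    simp only [mul_smul_comm, smul_mul_assoc, map_smul, LinearMap.smul_apply,
      smul_comm _ t, ← smul_add]
    congr 1
    by_cases h : (Path.ofArrow Q.double x).src = p.tgt
    · rw [← of_ofArrow_comp x p h, slide_ofArrow_comp]
    · have h_arrow_mul : arrow Q.double x * of p = 0 := of_mul_of_neg (Path.ofArrow _ x) p h
      have h_slide : Q.slide ε c (of p) (z * arrow Q.double x) = 0 := by
        rw [← (arrow_mem_corner Q.double x).2, ← mul_assoc, slide_of_mul_e]
        exact if_neg h
      rw [h_arrow_mul, h_slide, slide_arrow, map_zero, LinearMap.zero_apply, smul_zero, add_zero]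
      refine (ite_eq_right_iff.2 fun hx => ?_).symm
      rw [← hx, ← mul_assoc, e, of_mul_of_neg (Path.triv _ (Q.double.tail x)) p h, zero_mul,
        zero_mul]

theorem slide_inl_inr_mul_inl (b : E) {b' : E} {i : I} (hb' : Q.tail b' = i)
    {z : Q.double.PathAlgebra} (hz : z ∈ Q.double.corner i i) :
    Q.slide ε (Sum.inl b) (arrow Q.double (Sum.inr b') * arrow Q.double (Sum.inl b')) z =
      if b' = b then ε • (z * arrow Q.double (Sum.inr b)) else 0 := by
  subst hb'
  rw [slide_arrow_mul, slide_arrow, if_neg Sum.inr_ne_inl, zero_add, slide_arrow_of_mem_corner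
    (x := Sum.inl b') Q _ _ (mul_mem_corner hz (arrow_mem_corner Q.double (Sum.inr b'))),
    numDual_singleton_inr, pow_one]
  by_cases h : b' = b <;> simp [h]

theorem slide_inl_inl_mul_inr (b : E) {b' : E} {i : I} (hb' : Q.head b' = i)
    {z : Q.double.PathAlgebra} (hz : z ∈ Q.double.corner i i) :
    Q.slide ε (Sum.inl b) (arrow Q.double (Sum.inl b') * arrow Q.double (Sum.inr b')) z =
      if b' = b then arrow Q.double (Sum.inr b) * z else 0 := by
  subst hb'
  rw [slide_arrow_mul, slide_arrow Q _ _ (Sum.inr b'), if_neg Sum.inr_ne_inl, smul_zero, add_zero,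
    slide_arrow_of_mem_corner (x := Sum.inl b') Q _ _
      (mul_mem_corner (arrow_mem_corner Q.double (Sum.inr b')) hz)]
  by_cases h : b' = b <;> simp [h]

theorem slide_inr_inr_mul_inl (b : E) {b' : E} {i : I} (hb' : Q.tail b' = i)
    {z : Q.double.PathAlgebra} (hz : z ∈ Q.double.corner i i) :
    Q.slide ε (Sum.inr b) (arrow Q.double (Sum.inr b') * arrow Q.double (Sum.inl b')) z =
      if b' = b then arrow Q.double (Sum.inl b) * z else 0 := by
  subst hb'
  rw [slide_arrow_mul, slide_arrow Q _ _ (Sum.inl b'), if_neg Sum.inl_ne_inr, smul_zero, add_zero,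
    slide_arrow_of_mem_corner (x := Sum.inr b') Q _ _
      (mul_mem_corner (arrow_mem_corner Q.double (Sum.inl b')) hz)]
  by_cases h : b' = b <;> simp [h]

theorem slide_inr_inl_mul_inr (b : E) {b' : E} {i : I} (hb' : Q.head b' = i)
    {z : Q.double.PathAlgebra} (hz : z ∈ Q.double.corner i i) :
    Q.slide ε (Sum.inr b) (arrow Q.double (Sum.inl b') * arrow Q.double (Sum.inr b')) z =
      if b' = b then z * arrow Q.double (Sum.inl b) else 0 := by
  subst hb'
  rw [slide_arrow_mul, slide_arrow, if_neg Sum.inl_ne_inr, zero_add, slide_arrow_of_mem_corner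
    (x := Sum.inr b') Q _ _ (mul_mem_corner hz (arrow_mem_corner Q.double (Sum.inl b'))),
    numDual_singleton_inl, pow_zero, one_smul]
  by_cases h : b' = b <;> simp [h]

theorem slide_of_mul (p : Q.double.Path) (y z : Q.double.PathAlgebra) :
    Q.slide ε c (of p * y) z =
      Q.slide ε c (of p) (y * z) + ε ^ numDual p.word • Q.slide ε c y (z * of p) := by
  induction p using Path.induction generalizing y z with
  | triv i =>
    rw [of_triv, slide_e_mul, slide_e]
    simp [Path.triv, numDual]
  | cons x p h ih =>
    rw [slide_ofArrow_comp, of_ofArrow_comp, mul_assoc, slide_arrow_mul, ih,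
      show numDual ((Path.ofArrow Q.double x).comp p h).word = numDual [x] + numDual p.word from
        numDual_append _ _, pow_add, mul_smul, smul_add, mul_assoc, mul_assoc, mul_assoc, add_assoc]

theorem slide_of_e_src_mul (p : Q.double.Path) (z : Q.double.PathAlgebra) :
    Q.slide ε c (of p) (e Q.double p.src * z) = Q.slide ε c (of p) z := by
  simpa [of_mul_e_src] using (Q.slide_of_mul ε c p (e Q.double p.src) z).symm

theorem slide_mul {r : ℕ} {x : Q.double.PathAlgebra} (hx : x ∈ Q.grade r)
    (y z : Q.double.PathAlgebra) :
    Q.slide ε c (x * y) z = Q.slide ε c x (y * z) + ε ^ r • Q.slide ε c y (z * x) := by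
  induction hx using Submodule.span_induction with
  | zero => simp
  | add x x' _ _ hx hx' =>
    simp only [mul_add, add_mul, map_add, LinearMap.add_apply, hx, hx', smul_add]
    abel
  | smul t x _ hx =>
    simp only [smul_mul_assoc, mul_smul_comm, map_smul, LinearMap.smul_apply, hx, smul_add,
      smul_comm t]
  | mem x hx =>
    obtain ⟨p, rfl, rfl⟩ := hx
    exact Q.slide_of_mul ε c p y z

theorem slide_mem_parityGrade {r s : ℕ} {x z : Q.double.PathAlgebra} (hx : x ∈ Q.grade r)
    (hz : z ∈ Q.parityGrade s) : Q.slide ε c x z ∈ Q.parityGrade (r + s + numDual [c]) := by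
  induction hx using Submodule.span_induction with
  | zero => simp
  | add x y _ _ hx hy => simpa using add_mem hx hy
  | smul t x _ hx => simpa using Submodule.smul_mem _ t hx
  | mem x hx =>
    obtain ⟨p, rfl, rfl⟩ := hx
    induction p using Path.induction generalizing s z with
    | triv i => simp [of_triv]
    | cons x p h ih =>
      have h_numDual : numDual ((Path.ofArrow Q.double x).comp p h).word =
          numDual [x] + numDual p.word := numDual_append _ _
      rw [slide_ofArrow_comp, h_numDual]
      refine add_mem ?_ (Submodule.smul_mem _ _ ?_)
      · rw [slide_arrow]
        split_ifs with hxc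
        · have h_mul := mul_mem_parityGrade (mul_mem_parityGrade
            (Q.e_mem_parityGrade (Q.double.tail c))
            (mul_mem_parityGrade (of_mem_parityGrade (.refl (numDual p.word))) hz))
            (Q.e_mem_parityGrade (Q.double.head c))
          rwa [parityGrade_congr Q (s := numDual [x] + numDual p.word + s + numDual [c])] at h_mul
          rw [hxc, Nat.ModEq]
          omega
        · exact zero_mem _
      · have h_slide := ih (mul_mem_parityGrade hz (Q.arrow_mem_parityGrade x))
        rwa [show numDual [x] + numDual p.word + s + numDual [c] =
          numDual p.word + (s + numDual [x]) + numDual [c] by omega]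

end Slide

section SuperDeriv

variable [Fintype I] [DecidableEq I] [DecidableEq E] (Q : ArrowQuiver I E) (c : E ⊕ E)

theorem wordDeriv_eq_wordSlide {p : Q.double.Path} (hp : p.tgt = p.src) :
    Q.wordDeriv c p.word = (-1 : ℂ) ^ ((numDual p.word + 1) * numDual [c]) •
      Q.wordSlide ((-1) ^ (numDual p.word + 1)) c p.word 1 := by
  rw [wordDeriv, wordSlide, LinearMap.sum_apply, Finset.smul_sum]
  refine Finset.sum_congr rfl fun k _ => ?_
  split_ifs with hk
  · obtain ⟨hu, hv⟩ := p.isPath.split hk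
    have h_take : p.word.take (k + 1) = p.word.take k ++ [c] := by
      rw [List.take_add_one, hk, Option.toList_some]
    have h_numDual : numDual p.word =
        numDual (p.word.take k) + numDual [c] + numDual (p.word.drop (k + 1)) := by
      rw [← numDual_append, ← h_take, ← numDual_append, List.take_append_drop]
    have h_prod : e Q.double (Q.double.tail c) *
        ((p.word.drop (k + 1) ++ p.word.take k).map (arrow Q.double)).prod =
        e Q.double (Q.double.tail c) * ((p.word.drop (k + 1)).map (arrow Q.double)).prod *
          (((p.word.take k).map (arrow Q.double)).prod * e Q.double (Q.double.head c)) := by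
      rw [prod_map_arrow_mul_e hu, ← e_mul_prod_map_arrow hu, hp, ← mul_assoc,
        e_mul_prod_map_arrow hv, of_mul_e_src ⟨_, _, p.src, hv⟩, ← e_mul_prod_map_arrow hv,
        List.map_append, List.prod_append, mul_assoc]
    rw [h_prod, LinearMap.smul_apply, LinearMap.mulLeftRight_apply, mul_one, smul_smul, ← pow_mul,
      ← pow_add]
    congr 1
    refine neg_one_pow_congr ?_
    rw [h_take, numDual_append, h_numDual]
    simp only [Nat.even_add, Nat.even_mul, Nat.not_even_one]
    tauto
  · simp

theorem slide_one_eq_zero (ε : ℂ) {p : Q.double.Path} (hp : p.tgt ≠ p.src) :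
    Q.slide ε c (of p) 1 = 0 := by
  rw [← slide_of_e_src_mul, mul_one, ← one_mul (e Q.double p.src), slide_of_mul_e, if_neg hp.symm]

theorem superDeriv_mkQ {r : ℕ} {x : Q.double.PathAlgebra} (hx : x ∈ Q.grade r) :
    Q.superDeriv c (Q.superCommutators.mkQ x) =
      (-1 : ℂ) ^ ((r + 1) * numDual [c]) • Q.slide ((-1) ^ (r + 1)) c x 1 := by
  induction hx using Submodule.span_induction with
  | zero => simp
  | add x y _ _ hx hy => simp only [map_add, LinearMap.add_apply, hx, hy, smul_add]
  | smul t x _ hx => simp only [map_smul, LinearMap.smul_apply, hx, smul_comm t]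
  | mem x hx =>
    obtain ⟨p, rfl, rfl⟩ := hx
    rw [superDeriv, Submodule.mkQ_apply, Submodule.liftQ_apply, lift_of]
    split_ifs with hp
    · rw [slide_of, wordDeriv_eq_wordSlide Q c hp]
    · rw [slide_one_eq_zero Q c _ hp, smul_zero]

theorem superDeriv_mem_corner (γ : Q.Necklace) :
    Q.superDeriv c γ ∈ Q.double.corner (Q.double.tail c) (Q.double.head c) := by
  obtain ⟨x, rfl⟩ := Q.superCommutators.mkQ_surjective γ
  induction x using PathAlgebra.induction with
  | h0 => simp
  | hadd x y hx hy => simpa only [map_add] using add_mem hx hy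
  | hof t p =>
    rw [map_smul, map_smul, superDeriv_mkQ Q c (Q.of_mem_grade p)]
    exact Submodule.smul_mem _ _ (Submodule.smul_mem _ _ (Q.slide_mem_corner _ c _ _))

theorem superDeriv_mem_parityGrade {r : ℕ} {γ : Q.Necklace} (hγ : γ ∈ Q.necklaceGrade r) :
    Q.superDeriv c γ ∈ Q.parityGrade (r + numDual [c]) := by
  obtain ⟨x, hx, rfl⟩ := hγ
  have h_slide := Q.slide_mem_parityGrade ((-1) ^ (r + 1)) c hx Q.one_mem_parityGrade
  rw [superDeriv_mkQ Q c hx]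
  exact Submodule.smul_mem _ _ h_slide

end SuperDeriv

section Moment

variable [Fintype I] [DecidableEq I] [Fintype E] [DecidableEq E] (Q : ArrowQuiver I E)

theorem sum_slide_mul_arrow (ε : ℂ) (p : Q.double.Path) {z : Q.double.PathAlgebra}
    (hz : z ∈ Q.double.corner p.src p.tgt) :
    ∑ y, ε ^ numDual [y] • (Q.slide ε y (of p) z * arrow Q.double y) =
      ∑ y, arrow Q.double y * Q.slide ε y (of p) z +
        (ε ^ numDual p.word • (z * of p) - of p * z) := by
  induction p using Path.induction generalizing z with
  | triv i =>
    obtain ⟨hz_left, hz_right⟩ : z ∈ Q.double.corner i i := hz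
    simp only [of_triv, slide_e, LinearMap.zero_apply, zero_mul, mul_zero, smul_zero,
      Finset.sum_const_zero, hz_left, hz_right,
      show numDual (Path.triv Q.double i).word = 0 from rfl, pow_zero, one_smul, sub_self, add_zero]
  | cons x p h ih =>
    have hz_corner : z ∈ Q.double.corner p.src (Q.double.head x) := hz
    have hp_corner : of p ∈ Q.double.corner (Q.double.tail x) p.src :=
      (show Q.double.tail x = p.tgt from h) ▸ of_mem_corner p
    have h_arrow (y : E ⊕ E) := Q.slide_arrow_of_mem_corner ε y (mul_mem_corner hp_corner hz_corner)
    have h_ih := ih (z := z * arrow Q.double x)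
      (h ▸ mul_mem_corner hz (arrow_mem_corner Q.double x))
    have h_numDual : numDual ((Path.ofArrow Q.double x).comp p h).word =
        numDual [x] + numDual p.word := numDual_append _ _
    simp only [slide_ofArrow_comp, h_arrow, add_mul, mul_add, smul_add, Finset.sum_add_distrib,
      ite_mul, mul_ite, zero_mul, mul_zero, smul_ite, smul_zero, Finset.sum_ite_eq,
      Finset.mem_univ, if_true, smul_mul_assoc, mul_smul_comm]
    simp only [smul_comm _ (ε ^ numDual [x]), ← Finset.smul_sum, h_ih, of_ofArrow_comp, h_numDual,
      pow_add, mul_smul, smul_add, smul_sub, mul_assoc]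
    abel

theorem sum_superDeriv_mul_arrow {r : ℕ} {γ : Q.Necklace} (hγ : γ ∈ Q.necklaceGrade r) :
    ∑ y, Q.superDeriv y γ * arrow Q.double y =
      ∑ y, (-1 : ℂ) ^ ((r + 1) * numDual [y]) • (arrow Q.double y * Q.superDeriv y γ) := by
  suffices h : (∑ y, LinearMap.mulRight ℂ (arrow Q.double y) ∘ₗ Q.superDeriv y) γ =
      (∑ y, (-1 : ℂ) ^ ((r + 1) * numDual [y]) •
        (LinearMap.mulLeft ℂ (arrow Q.double y) ∘ₗ Q.superDeriv y)) γ by simpa using h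
  refine eq_of_mem_necklaceGrade (fun p hp hr => ?_) hγ
  have h_even : Even ((r + 1) * r) := by rw [mul_comm]; exact Nat.even_mul_succ_self r
  have h_slide := Q.sum_slide_mul_arrow ((-1) ^ (r + 1)) p (z := e Q.double p.tgt)
    (hp ▸ e_mem_corner Q.double p.tgt)
  have h_one (y : E ⊕ E) := Q.slide_e_of_mem_corner ((-1) ^ (r + 1)) y (of_mem_corner p)
  have h_comm : ((-1 : ℂ) ^ (r + 1)) ^ numDual p.word • (e Q.double p.tgt * of p) -
      of p * e Q.double p.tgt = 0 := by
    rw [hr, ← pow_mul, h_even.neg_one_pow, one_smul, e_tgt_mul_of, hp, of_mul_e_src, sub_self]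
  simp only [h_one, h_comm, add_zero] at h_slide
  simp only [← pow_mul] at h_slide
  simpa only [LinearMap.sum_apply, LinearMap.comp_apply, LinearMap.smul_apply,
    LinearMap.mulRight_apply, LinearMap.mulLeft_apply, superDeriv_mkQ Q _ (hr ▸ Q.of_mem_grade p),
    smul_mul_assoc, mul_smul_comm, smul_smul, neg_one_pow_mul_self, one_smul] using h_slide

theorem sum_superDeriv_mul_arrow_at {r : ℕ} {γ : Q.Necklace} (hγ : γ ∈ Q.necklaceGrade r) (i : I) :
    (∑ y, if i = Q.double.tail y then Q.superDeriv y γ * arrow Q.double y else 0) =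
      ∑ y, if i = Q.double.head y then
        (-1 : ℂ) ^ ((r + 1) * numDual [y]) • (arrow Q.double y * Q.superDeriv y γ) else 0 := by
  have h := congrArg (e Q.double i * ·) (Q.sum_superDeriv_mul_arrow hγ)
  simp only [Finset.mul_sum, mul_smul_comm] at h
  simpa only [e_mul_of_mem_corner (mul_mem_corner (Q.superDeriv_mem_corner _ γ)
      (arrow_mem_corner Q.double _)), e_mul_of_mem_corner (mul_mem_corner
      (arrow_mem_corner Q.double _) (Q.superDeriv_mem_corner _ γ)), smul_ite, smul_zero] using h

end Moment

section Contraction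

variable [Fintype I] [DecidableEq I] [Fintype E] [DecidableEq E] (Q : ArrowQuiver I E) (a : E)
  (ha : Q.head a ≠ Q.tail a)

/-- The substitution on the whole path algebra. It is multiplicative only on elements whose
idempotents match, since paths that are not composable in `Q` may become composable in `Q_a`. -/
def contractMap : Q.double.PathAlgebra →ₗ[ℂ] (Q.contract a ha).double.PathAlgebra :=
  lift (Q.contractPath a ha)

theorem contractMap_of (p : Q.double.Path) :
    Q.contractMap a ha (of p) = Q.contractPath a ha p :=
  lift_of _ p

theorem contractMap_e (i : I) :
    Q.contractMap a ha (e Q.double i) = e (Q.contract a ha).double (Q.fuse a ha i) :=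
  (Q.contractMap_of a ha _).trans (mul_one _)

theorem contractMap_arrow (x : E ⊕ E) :
    Q.contractMap a ha (arrow Q.double x) =
      e (Q.contract a ha).double (Q.fuse a ha (Q.double.head x)) * Q.contractArrow a ha x := by
  rw [arrow, contractMap_of, contractPath, Path.ofArrow, List.map_singleton, List.prod_singleton]

theorem contractMap_mul {i j k : I} {x y : Q.double.PathAlgebra} (hx : x ∈ Q.double.corner i j)
    (hy : y ∈ Q.double.corner j k) :
    Q.contractMap a ha (x * y) = Q.contractMap a ha x * Q.contractMap a ha y := by
  suffices h : Q.contractMap a ha (x * e Q.double j * (e Q.double j * y)) =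
      Q.contractMap a ha (x * e Q.double j) * Q.contractMap a ha (e Q.double j * y) by
    rwa [hx.2, hy.1] at h
  clear hx hy
  induction x using PathAlgebra.induction with
  | h0 => simp
  | hadd x x' hx hx' => simp only [add_mul, map_add, hx, hx']
  | hof s p =>
    induction y using PathAlgebra.induction with
    | h0 => simp
    | hadd y y' hy hy' => simp only [mul_add, map_add, hy, hy']
    | hof t q =>
      simp only [smul_mul_assoc, mul_smul_comm, map_smul, of_mul_e, e_mul_of]
      split_ifs with hp hq
      · rw [of_mul_of_pos p q (hp.trans hq), contractMap_of, contractMap_of, contractMap_of,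
          contractPath_comp]
      all_goals simp

theorem contractMap_mem_corner {i j : I} {x : Q.double.PathAlgebra} (hx : x ∈ Q.double.corner i j) :
    Q.contractMap a ha x ∈ (Q.contract a ha).double.corner (Q.fuse a ha i) (Q.fuse a ha j) :=
  ⟨by rw [← contractMap_e, ← contractMap_mul Q a ha (e_mem_corner Q.double i) hx, hx.1],
    by rw [← contractMap_e, ← contractMap_mul Q a ha hx (e_mem_corner Q.double j), hx.2]⟩

theorem contractMap_of_mem_grade (p : Q.double.Path) :
    Q.contractMap a ha (of p) ∈ (Q.contract a ha).grade (numDual p.word) := by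
  rw [contractMap_of]
  exact Q.contractPath_mem_grade a ha p

theorem contractMap_mem_parityGrade {r : ℕ} {x : Q.double.PathAlgebra} (hx : x ∈ Q.parityGrade r) :
    Q.contractMap a ha x ∈ (Q.contract a ha).parityGrade r := by
  suffices h : Q.parityGrade r ≤ ((Q.contract a ha).parityGrade r).comap (Q.contractMap a ha) from
    h hx
  refine Submodule.span_le.2 ?_
  rintro _ ⟨p, hp, rfl⟩
  rw [SetLike.mem_coe, Submodule.mem_comap, ← parityGrade_congr _ hp]
  exact grade_le_parityGrade _ _ (Q.contractMap_of_mem_grade a ha p)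

theorem contractNecklace_mkQ_of {p : Q.double.Path} (hp : p.tgt = p.src) :
    Q.contractNecklace a ha (Q.superCommutators.mkQ (of p)) =
      (Q.contract a ha).superCommutators.mkQ (Q.contractMap a ha (of p)) := by
  rw [contractNecklace, Submodule.mkQ_apply, Submodule.liftQ_apply, lift_of, if_pos hp,
    contractMap_of]

theorem contractNecklace_mkQ {i : I} {x : Q.double.PathAlgebra} (hx : x ∈ Q.double.corner i i) :
    Q.contractNecklace a ha (Q.superCommutators.mkQ x) =
      (Q.contract a ha).superCommutators.mkQ (Q.contractMap a ha x) := by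
  suffices h : Q.contractNecklace a ha
      (Q.superCommutators.mkQ (e Q.double i * x * e Q.double i)) =
      (Q.contract a ha).superCommutators.mkQ
        (Q.contractMap a ha (e Q.double i * x * e Q.double i)) by
    rwa [hx.1, hx.2] at h
  clear hx
  induction x using PathAlgebra.induction with
  | h0 => simp
  | hadd x y hx hy => simp only [mul_add, add_mul, map_add, hx, hy]
  | hof t p =>
    simp only [mul_smul_comm, smul_mul_assoc, map_smul, e_mul_of]
    split_ifs with h_tgt
    · rw [of_mul_e]
      split_ifs with h_src
      · rw [contractNecklace_mkQ_of Q a ha (h_tgt.symm.trans h_src.symm)]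
      · simp
    · simp

theorem contractNecklace_mem_necklaceGrade {r : ℕ} {γ : Q.Necklace} (hγ : γ ∈ Q.necklaceGrade r) :
    Q.contractNecklace a ha γ ∈ (Q.contract a ha).necklaceGrade r := by
  refine necklaceGrade_le (N := ((Q.contract a ha).necklaceGrade r).comap (Q.contractNecklace a ha))
    (fun p hp hr => ?_) hγ
  rw [Submodule.mem_comap, contractNecklace_mkQ_of Q a ha hp]
  exact Submodule.mem_map_of_mem (hr ▸ Q.contractMap_of_mem_grade a ha p)

theorem slide_contractMap (ε : ℂ) (c : {b // b ≠ a} ⊕ {b // b ≠ a}) (p : Q.double.Path)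
    {z : Q.double.PathAlgebra} (hz : z ∈ Q.double.corner p.src p.tgt) :
    (Q.contract a ha).slide ε c (Q.contractMap a ha (of p)) (Q.contractMap a ha z) =
      ∑ y, (Q.contract a ha).slide ε c (Q.contractMap a ha (arrow Q.double y))
        (Q.contractMap a ha (Q.slide ε y (of p) z)) := by
  induction p using Path.induction generalizing z with
  | triv i => simp [of_triv, contractMap_e]
  | cons x p h ih =>
    have hz_corner : z ∈ Q.double.corner p.src (Q.double.head x) := hz
    have hp_corner : of p ∈ Q.double.corner (Q.double.tail x) p.src :=
      (show Q.double.tail x = p.tgt from h) ▸ of_mem_corner p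
    have h_arrow (y : E ⊕ E) := Q.slide_arrow_of_mem_corner ε y (mul_mem_corner hp_corner hz_corner)
    have h_ih := ih (z := z * arrow Q.double x)
      (h ▸ mul_mem_corner hz (arrow_mem_corner Q.double x))
    have h_mem : Q.contractMap a ha (arrow Q.double x) ∈ (Q.contract a ha).grade (numDual [x]) :=
      Q.contractMap_of_mem_grade a ha (Path.ofArrow Q.double x)
    rw [of_ofArrow_comp, contractMap_mul Q a ha (arrow_mem_corner Q.double x) hp_corner,
      slide_mul _ ε c h_mem, ← contractMap_mul Q a ha hp_corner hz_corner,
      ← contractMap_mul Q a ha hz_corner (arrow_mem_corner Q.double x), h_ih]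
    simp only [← of_ofArrow_comp x p h, slide_ofArrow_comp, h_arrow, map_add, map_smul,
      Finset.sum_add_distrib, ← Finset.smul_sum, apply_ite, map_zero, Finset.sum_ite_eq,
      Finset.mem_univ, if_true]

end Contraction

section ContractionDerivative

variable [Fintype I] [DecidableEq I] [Fintype E] [DecidableEq E] (Q : ArrowQuiver I E) (a : E)
  (ha : Q.head a ≠ Q.tail a)

theorem contractMap_arrow_inl_self :
    Q.contractMap a ha (arrow Q.double (Sum.inl a)) =
      e (Q.contract a ha).double (Q.fuse a ha (Q.head a)) := by
  rw [contractMap_arrow, contractArrow, dif_pos rfl, mul_one]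
  rfl

theorem contractMap_arrow_inl (b : {b // b ≠ a}) :
    Q.contractMap a ha (arrow Q.double (Sum.inl b)) =
      arrow (Q.contract a ha).double (Sum.inl b) := by
  rw [contractMap_arrow, contractArrow, dif_neg b.2]
  exact (arrow_mem_corner (Q.contract a ha).double (Sum.inl b)).1

theorem contractMap_arrow_inr (b : {b // b ≠ a}) :
    Q.contractMap a ha (arrow Q.double (Sum.inr b)) =
      arrow (Q.contract a ha).double (Sum.inr b) := by
  rw [contractMap_arrow, contractArrow, dif_neg b.2]
  exact (arrow_mem_corner (Q.contract a ha).double (Sum.inr b)).1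

theorem contractMap_arrow_inr_self :
    Q.contractMap a ha (arrow Q.double (Sum.inr a)) = ∑ b : {b // b ≠ a},
      ((if Q.tail b = Q.head a then arrow (Q.contract a ha).double (Sum.inr b) *
          arrow (Q.contract a ha).double (Sum.inl b) else 0) -
        if Q.head b = Q.head a then arrow (Q.contract a ha).double (Sum.inl b) *
          arrow (Q.contract a ha).double (Sum.inr b) else 0) := by
  have h_tail : Q.contractArrow a ha (Sum.inr a) *
      e (Q.contract a ha).double (Q.fuse a ha (Q.head a)) =
        Q.contractMap a ha (arrow Q.double (Sum.inr a)) := by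
    rw [contractMap_arrow]
    exact (Q.e_mul_contractArrow a ha (Sum.inr a)).symm
  rw [← h_tail, contractArrow, dif_pos rfl, Finset.sum_filter, Finset.sum_filter,
    ← Finset.sum_sub_distrib, Finset.sum_mul]
  refine Finset.sum_congr rfl fun b _ => ?_
  rw [sub_mul, ite_mul, ite_mul, zero_mul]
  congr 1
  · refine ite_congr rfl (fun hb => ?_) fun _ => rfl
    rw [mul_assoc, arrow_mul_e _ (congrArg (Q.fuse a ha) hb)]
  · refine ite_congr rfl (fun hb => ?_) fun _ => rfl
    rw [mul_assoc, arrow_mul_e _ (congrArg (Q.fuse a ha) hb)]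

theorem slide_inl_contractMap_arrow_inr_self (ε : ℂ) (b : {b // b ≠ a})
    {u : (Q.contract a ha).double.PathAlgebra}
    (hu : u ∈ (Q.contract a ha).double.corner (Q.fuse a ha (Q.head a)) (Q.fuse a ha (Q.head a))) :
    (Q.contract a ha).slide ε (Sum.inl b) (Q.contractMap a ha (arrow Q.double (Sum.inr a))) u =
      (if Q.tail b = Q.head a then
        ε • (u * arrow (Q.contract a ha).double (Sum.inr b)) else 0) -
      if Q.head b = Q.head a then arrow (Q.contract a ha).double (Sum.inr b) * u else 0 := by
  have h_tail (b' : {b // b ≠ a}) (hb' : Q.tail b' = Q.head a) :=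
    slide_inl_inr_mul_inl (Q.contract a ha) ε b (congrArg (Q.fuse a ha) hb') hu
  have h_head (b' : {b // b ≠ a}) (hb' : Q.head b' = Q.head a) :=
    slide_inl_inl_mul_inr (Q.contract a ha) ε b (congrArg (Q.fuse a ha) hb') hu
  rw [contractMap_arrow_inr_self, map_sum, LinearMap.sum_apply,
    Finset.sum_eq_single_of_mem b (Finset.mem_univ b)]
  · rw [map_sub, LinearMap.sub_apply]
    congr 1
    · split_ifs with hb <;> simp [h_tail, hb]
    · split_ifs with hb <;> simp [h_head, hb]
  · intro b' _ h_ne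
    rw [map_sub, LinearMap.sub_apply]
    split_ifs with hbt hbh hbh <;> simp [h_tail, h_head, hbt, hbh, h_ne]

theorem slide_inr_contractMap_arrow_inr_self (ε : ℂ) (b : {b // b ≠ a})
    {u : (Q.contract a ha).double.PathAlgebra}
    (hu : u ∈ (Q.contract a ha).double.corner (Q.fuse a ha (Q.head a)) (Q.fuse a ha (Q.head a))) :
    (Q.contract a ha).slide ε (Sum.inr b) (Q.contractMap a ha (arrow Q.double (Sum.inr a))) u =
      (if Q.tail b = Q.head a then
        arrow (Q.contract a ha).double (Sum.inl b) * u else 0) -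
      if Q.head b = Q.head a then u * arrow (Q.contract a ha).double (Sum.inl b) else 0 := by
  have h_tail (b' : {b // b ≠ a}) (hb' : Q.tail b' = Q.head a) :=
    slide_inr_inr_mul_inl (Q.contract a ha) ε b (congrArg (Q.fuse a ha) hb') hu
  have h_head (b' : {b // b ≠ a}) (hb' : Q.head b' = Q.head a) :=
    slide_inr_inl_mul_inr (Q.contract a ha) ε b (congrArg (Q.fuse a ha) hb') hu
  rw [contractMap_arrow_inr_self, map_sum, LinearMap.sum_apply,
    Finset.sum_eq_single_of_mem b (Finset.mem_univ b)]
  · rw [map_sub, LinearMap.sub_apply]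
    congr 1
    · split_ifs with hb <;> simp [h_tail, hb]
    · split_ifs with hb <;> simp [h_head, hb]
  · intro b' _ h_ne
    rw [map_sub, LinearMap.sub_apply]
    split_ifs with hbt hbh hbh <;> simp [h_tail, h_head, hbt, hbh, h_ne]

theorem contractMap_superDeriv_inr_self_mem_corner (γ : Q.Necklace) :
    Q.contractMap a ha (Q.superDeriv (Sum.inr a) γ) ∈
      (Q.contract a ha).double.corner (Q.fuse a ha (Q.head a)) (Q.fuse a ha (Q.head a)) := by
  have h := Q.contractMap_mem_corner a ha (Q.superDeriv_mem_corner (Sum.inr a) γ)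
  rwa [show Q.double.head (Sum.inr a) = Q.tail a from rfl, ← Q.fuse_head a ha] at h

theorem superDeriv_contractNecklace (c : {b // b ≠ a} ⊕ {b // b ≠ a}) {r : ℕ} {γ : Q.Necklace}
    (hγ : γ ∈ Q.necklaceGrade r) :
    (Q.contract a ha).superDeriv c (Q.contractNecklace a ha γ) =
      (-1 : ℂ) ^ ((r + 1) * numDual [c]) • ∑ y, (-1 : ℂ) ^ ((r + 1) * numDual [y]) •
        (Q.contract a ha).slide ((-1) ^ (r + 1)) c (Q.contractMap a ha (arrow Q.double y))
          (Q.contractMap a ha (Q.superDeriv y γ)) := by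
  suffices h : ((Q.contract a ha).superDeriv c ∘ₗ Q.contractNecklace a ha) γ =
      ((-1 : ℂ) ^ ((r + 1) * numDual [c]) • ∑ y, (-1 : ℂ) ^ ((r + 1) * numDual [y]) •
        (Q.contract a ha).slide ((-1) ^ (r + 1)) c (Q.contractMap a ha (arrow Q.double y)) ∘ₗ
          Q.contractMap a ha ∘ₗ Q.superDeriv y) γ by simpa using h
  refine eq_of_mem_necklaceGrade (fun p hp hr => ?_) hγ
  have h_slide := Q.slide_contractMap a ha ((-1) ^ (r + 1)) c p (z := e Q.double p.tgt)
    (hp ▸ e_mem_corner Q.double p.tgt)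
  rw [contractMap_e, slide_e_of_mem_corner _ _ _
    (Q.contractMap_mem_corner a ha (of_mem_corner p))] at h_slide
  simp only [Q.slide_e_of_mem_corner _ _ (of_mem_corner p)] at h_slide
  rw [LinearMap.comp_apply, contractNecklace_mkQ_of Q a ha hp,
    superDeriv_mkQ _ c (hr ▸ Q.contractMap_of_mem_grade a ha p), h_slide]
  simp only [LinearMap.smul_apply, LinearMap.sum_apply, LinearMap.comp_apply,
    superDeriv_mkQ Q _ (hr ▸ Q.of_mem_grade p), map_smul, smul_smul, neg_one_pow_mul_self, one_smul]

theorem superDeriv_inl_contractNecklace (b : {b // b ≠ a}) {r : ℕ} {γ : Q.Necklace}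
    (hγ : γ ∈ Q.necklaceGrade r) :
    (Q.contract a ha).superDeriv (Sum.inl b) (Q.contractNecklace a ha γ) =
      Q.contractMap a ha (Q.superDeriv (Sum.inl b) γ) +
      (if Q.tail b = Q.head a then Q.contractMap a ha (Q.superDeriv (Sum.inr a) γ) *
        arrow (Q.contract a ha).double (Sum.inr b) else 0) -
      if Q.head b = Q.head a then (-1 : ℂ) ^ (r + 1) • (arrow (Q.contract a ha).double (Sum.inr b) *
        Q.contractMap a ha (Q.superDeriv (Sum.inr a) γ)) else 0 := by
  have h_inl (b' : {b // b ≠ a}) : (Q.contract a ha).slide ((-1) ^ (r + 1)) (Sum.inl b)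
      (arrow (Q.contract a ha).double (Sum.inl b'))
        (Q.contractMap a ha (Q.superDeriv (Sum.inl b') γ)) =
      if (Sum.inl b' : {b // b ≠ a} ⊕ {b // b ≠ a}) = Sum.inl b then
        Q.contractMap a ha (Q.superDeriv (Sum.inl b') γ) else 0 :=
    slide_arrow_of_mem_corner _ _ _
      (Q.contractMap_mem_corner a ha (Q.superDeriv_mem_corner (Sum.inl b'.1) γ))
  have h_inr (b' : {b // b ≠ a}) (z : (Q.contract a ha).double.PathAlgebra) :
      (Q.contract a ha).slide ((-1) ^ (r + 1)) (Sum.inl b)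
        (arrow (Q.contract a ha).double (Sum.inr b')) z = 0 :=
    (slide_arrow _ _ _ _ z).trans (if_neg Sum.inr_ne_inl)
  rw [superDeriv_contractNecklace Q a ha _ hγ, Fintype.sum_sum_type,
    Fintype.sum_eq_add_sum_subtype_ne _ a, Fintype.sum_eq_add_sum_subtype_ne _ a]
  simp only [contractMap_arrow_inl_self, contractMap_arrow_inl, contractMap_arrow_inr, slide_e,
    slide_inl_contractMap_arrow_inr_self Q a ha _ b
      (Q.contractMap_superDeriv_inr_self_mem_corner a ha γ), h_inl, h_inr, Sum.inl.injEq,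
    numDual_singleton_inl, numDual_singleton_inr, mul_zero, mul_one, pow_zero, one_smul,
    LinearMap.zero_apply, smul_zero, zero_add, add_zero, Finset.sum_const_zero, Finset.sum_ite_eq',
    Finset.mem_univ, if_true, smul_sub, smul_ite, smul_smul, neg_one_pow_mul_self, add_sub_assoc]

theorem superDeriv_inr_contractNecklace (b : {b // b ≠ a}) {r : ℕ} {γ : Q.Necklace}
    (hγ : γ ∈ Q.necklaceGrade r) :
    (Q.contract a ha).superDeriv (Sum.inr b) (Q.contractNecklace a ha γ) =
      Q.contractMap a ha (Q.superDeriv (Sum.inr b) γ) +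
      (if Q.tail b = Q.head a then arrow (Q.contract a ha).double (Sum.inl b) *
        Q.contractMap a ha (Q.superDeriv (Sum.inr a) γ) else 0) -
      if Q.head b = Q.head a then Q.contractMap a ha (Q.superDeriv (Sum.inr a) γ) *
        arrow (Q.contract a ha).double (Sum.inl b) else 0 := by
  have h_inl (b' : {b // b ≠ a}) (z : (Q.contract a ha).double.PathAlgebra) :
      (Q.contract a ha).slide ((-1) ^ (r + 1)) (Sum.inr b)
        (arrow (Q.contract a ha).double (Sum.inl b')) z = 0 :=
    (slide_arrow _ _ _ _ z).trans (if_neg Sum.inl_ne_inr)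
  have h_inr (b' : {b // b ≠ a}) : (Q.contract a ha).slide ((-1) ^ (r + 1)) (Sum.inr b)
      (arrow (Q.contract a ha).double (Sum.inr b'))
        (Q.contractMap a ha (Q.superDeriv (Sum.inr b') γ)) =
      if (Sum.inr b' : {b // b ≠ a} ⊕ {b // b ≠ a}) = Sum.inr b then
        Q.contractMap a ha (Q.superDeriv (Sum.inr b') γ) else 0 :=
    slide_arrow_of_mem_corner _ _ _
      (Q.contractMap_mem_corner a ha (Q.superDeriv_mem_corner (Sum.inr b'.1) γ))
  rw [superDeriv_contractNecklace Q a ha _ hγ, Fintype.sum_sum_type,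
    Fintype.sum_eq_add_sum_subtype_ne _ a, Fintype.sum_eq_add_sum_subtype_ne _ a]
  simp only [contractMap_arrow_inl_self, contractMap_arrow_inl, contractMap_arrow_inr, slide_e,
    slide_inr_contractMap_arrow_inr_self Q a ha _ b
      (Q.contractMap_superDeriv_inr_self_mem_corner a ha γ), h_inl, h_inr, Sum.inr.injEq,
    numDual_singleton_inl, numDual_singleton_inr, mul_zero, mul_one, pow_zero, one_smul,
    LinearMap.zero_apply, smul_zero, zero_add, Finset.sum_const_zero, Finset.sum_ite_eq',
    Finset.mem_univ, if_true, smul_add, smul_sub, smul_ite, smul_smul, neg_one_pow_mul_self]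
  abel

end ContractionDerivative

section CorrectedProduct

variable [Fintype I] [DecidableEq I] {Q : ArrowQuiver I E}

theorem mkQ_corrected_mul (p q : Prop) [Decidable p] [Decidable q] {r s : ℕ}
    {B C N Y M' N' Y' : Q.double.PathAlgebra} (hB : B ∈ Q.parityGrade 0) (hC : C ∈ Q.parityGrade 1)
    (hN : N ∈ Q.parityGrade (r + 1)) (hY : Y ∈ Q.parityGrade (r + 1)) (hM' : M' ∈ Q.parityGrade s)
    (hN' : N' ∈ Q.parityGrade (s + 1)) (hY' : Y' ∈ Q.parityGrade (s + 1)) :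
    Q.superCommutators.mkQ
      ((N + (if p then B * Y else 0) - if q then Y * B else 0) *
        (M' + (if p then Y' * C else 0) - if q then (-1 : ℂ) ^ (s + 1) • (C * Y') else 0)) =
      Q.superCommutators.mkQ (N * M' + Y *
        ((if p then M' * B - (-1 : ℂ) ^ (s + 1) • (C * N') + Y' * (C * B) else 0) +
          if q then N' * C - B * M' - Y' * (B * C) else 0)) +
      ((-1 : ℂ) ^ (s + 1) • Q.superCommutators.mkQ
        ((if p then Y * (C * N') else 0) + (if q then (Y * B - N) * (C * Y') else 0) -
          if p ∧ q then B * (Y * (C * Y')) else 0) +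
      (-1 : ℂ) ^ ((r + 1) * (s + 1)) • (-1 : ℂ) ^ (r + 1) • Q.superCommutators.mkQ
        ((if p then Y' * (C * N) else 0) + (if q then (Y' * B - N') * (C * Y) else 0) -
          if p ∧ q then B * (Y' * (C * Y)) else 0)) := by
  have h_mul_C {x : Q.double.PathAlgebra} (hx : x ∈ Q.parityGrade (s + 1)) :
      x * C ∈ Q.parityGrade s :=
    Q.parityGrade_congr (show s + 1 + 1 ≡ s [MOD 2] by simp [Nat.ModEq, add_assoc]) ▸
      mul_mem_parityGrade hx hC
  have hBY : B * (Y' * C) ∈ Q.parityGrade s :=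
    zero_add s ▸ mul_mem_parityGrade hB (h_mul_C hY')
  have hYB : Y' * B ∈ Q.parityGrade (s + 1) :=
    add_zero (s + 1) ▸ mul_mem_parityGrade hY' hB
  have h₁ := mkQ_mul_comm_of_succ hN (h_mul_C hY')
  have h₂ := mkQ_mul_comm_of_succ hY (h_mul_C hN')
  have h₃ := mkQ_mul_comm_of_succ hY (h_mul_C hYB)
  have h₄ := mkQ_mul_comm_of_succ hY hBY
  have h₅ := mkQ_mul_comm_of_even hB (mul_mem_parityGrade hY hM')
  have h₆ := mkQ_mul_comm_of_even hB (mul_mem_parityGrade hY (h_mul_C hY'))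
  simp only [mul_assoc] at h₁ h₂ h₃ h₄ h₅ h₆
  by_cases hp : p <;> by_cases hq : q <;>
    simp only [hp, hq, if_true, if_false, and_true, and_false, and_self, add_mul, sub_mul, mul_add,
      mul_sub, mul_assoc, map_add, map_sub, map_smul, mul_smul_comm, h₁, h₂, h₃,
      h₄, h₅, h₆, add_zero, zero_add, sub_zero, mul_zero, map_zero]
  all_goals module

end CorrectedProduct

section Reduction

variable [Fintype I] [DecidableEq I] [Fintype E] [DecidableEq E] (Q : ArrowQuiver I E) (a : E)
  (ha : Q.head a ≠ Q.tail a)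

/-- The contribution of an arrow `b ≠ a` to the image of `D_a γ` in the path algebra of `Q_a`, when
the moment map identity at the vertex `h(a)` is solved for `D_a γ`. Here `r` is the degree of
`γ`. -/
def momentTerm (r : ℕ) (γ : Q.Necklace) (b : {b // b ≠ a}) : (Q.contract a ha).double.PathAlgebra :=
  (if Q.tail b = Q.head a then
    Q.contractMap a ha (Q.superDeriv (Sum.inl b) γ) * arrow (Q.contract a ha).double (Sum.inl b) -
      (-1 : ℂ) ^ (r + 1) • (arrow (Q.contract a ha).double (Sum.inr b) *
        Q.contractMap a ha (Q.superDeriv (Sum.inr b) γ)) +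
      Q.contractMap a ha (Q.superDeriv (Sum.inr a) γ) *
        (arrow (Q.contract a ha).double (Sum.inr b) * arrow (Q.contract a ha).double (Sum.inl b))
  else 0) +
  if Q.head b = Q.head a then
    Q.contractMap a ha (Q.superDeriv (Sum.inr b) γ) * arrow (Q.contract a ha).double (Sum.inr b) -
      arrow (Q.contract a ha).double (Sum.inl b) *
        Q.contractMap a ha (Q.superDeriv (Sum.inl b) γ) -
      Q.contractMap a ha (Q.superDeriv (Sum.inr a) γ) *
        (arrow (Q.contract a ha).double (Sum.inl b) * arrow (Q.contract a ha).double (Sum.inr b))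
  else 0

theorem sum_momentTerm {r : ℕ} {γ : Q.Necklace} (hγ : γ ∈ Q.necklaceGrade r) :
    ∑ b, Q.momentTerm a ha r γ b = Q.contractMap a ha (Q.superDeriv (Sum.inl a) γ) := by
  have h_deriv_arrow (y : E ⊕ E) := Q.contractMap_mul a ha (Q.superDeriv_mem_corner y γ)
    (arrow_mem_corner Q.double y)
  have h_arrow_deriv (y : E ⊕ E) := Q.contractMap_mul a ha (arrow_mem_corner Q.double y)
    (Q.superDeriv_mem_corner y γ)
  have h_self : e (Q.contract a ha).double (Q.fuse a ha (Q.head a)) *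
      Q.contractMap a ha (Q.superDeriv (Sum.inl a) γ) =
        Q.contractMap a ha (Q.superDeriv (Sum.inl a) γ) := by
    rw [Q.fuse_head a ha]
    exact (Q.contractMap_mem_corner a ha (Q.superDeriv_mem_corner (Sum.inl a) γ)).1
  have h := congrArg (Q.contractMap a ha) (Q.sum_superDeriv_mul_arrow_at hγ (Q.head a))
  have h_tail_inl (b : E) : Q.head a = Q.double.tail (Sum.inl b) ↔ Q.tail b = Q.head a := eq_comm
  have h_tail_inr (b : E) : Q.head a = Q.double.tail (Sum.inr b) ↔ Q.head b = Q.head a := eq_comm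
  have h_head_inl (b : E) : Q.head a = Q.double.head (Sum.inl b) ↔ Q.head b = Q.head a := eq_comm
  have h_head_inr (b : E) : Q.head a = Q.double.head (Sum.inr b) ↔ Q.tail b = Q.head a := eq_comm
  rw [map_sum, map_sum] at h
  simp only [apply_ite (Q.contractMap a ha), map_smul, map_zero, h_deriv_arrow, h_arrow_deriv,
    Fintype.sum_sum_type, Fintype.sum_eq_add_sum_subtype_ne _ a, contractMap_arrow_inl_self,
    contractMap_arrow_inl, contractMap_arrow_inr, numDual_singleton_inl, numDual_singleton_inr,
    mul_zero, mul_one, pow_zero, one_smul, h_tail_inl, h_tail_inr, h_head_inl, h_head_inr,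
    ha.symm, if_true, if_false, zero_add, h_self, contractMap_arrow_inr_self, Finset.mul_sum,
    mul_sub, mul_ite] at h
  simp only [add_assoc, ← Finset.sum_add_distrib] at h
  rw [eq_sub_of_add_eq h.symm, ← Finset.sum_sub_distrib]
  refine Finset.sum_congr rfl fun b _ => ?_
  rw [momentTerm]
  split_ifs <;> abel

/-- The part of `D_{b*}(γ_a) D_b(δ_a)` that is cancelled by its graded mirror image in
`[γ_a, δ_a]`. Here `s` is the degree of `δ`. -/
def crossTerm (s : ℕ) (γ δ : Q.Necklace) (b : {b // b ≠ a}) : (Q.contract a ha).Necklace :=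
  (-1 : ℂ) ^ (s + 1) • (Q.contract a ha).superCommutators.mkQ
    ((if Q.tail b = Q.head a then Q.contractMap a ha (Q.superDeriv (Sum.inr a) γ) *
        (arrow (Q.contract a ha).double (Sum.inr b) *
          Q.contractMap a ha (Q.superDeriv (Sum.inr b) δ)) else 0) +
      (if Q.head b = Q.head a then
        (Q.contractMap a ha (Q.superDeriv (Sum.inr a) γ) *
          arrow (Q.contract a ha).double (Sum.inl b) -
            Q.contractMap a ha (Q.superDeriv (Sum.inr b) γ)) *
          (arrow (Q.contract a ha).double (Sum.inr b) *
            Q.contractMap a ha (Q.superDeriv (Sum.inr a) δ)) else 0) -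
      if Q.tail b = Q.head a ∧ Q.head b = Q.head a then
        arrow (Q.contract a ha).double (Sum.inl b) *
          (Q.contractMap a ha (Q.superDeriv (Sum.inr a) γ) *
            (arrow (Q.contract a ha).double (Sum.inr b) *
              Q.contractMap a ha (Q.superDeriv (Sum.inr a) δ))) else 0)

theorem mkQ_superDeriv_mul_superDeriv_contractNecklace {r s : ℕ} {γ δ : Q.Necklace}
    (hγ : γ ∈ Q.necklaceGrade r) (hδ : δ ∈ Q.necklaceGrade s) (b : {b // b ≠ a}) :
    (Q.contract a ha).superCommutators.mkQ
      ((Q.contract a ha).superDeriv (Sum.inr b) (Q.contractNecklace a ha γ) *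
        (Q.contract a ha).superDeriv (Sum.inl b) (Q.contractNecklace a ha δ)) =
      (Q.contract a ha).superCommutators.mkQ
        (Q.contractMap a ha (Q.superDeriv (Sum.inr b) γ) *
            Q.contractMap a ha (Q.superDeriv (Sum.inl b) δ) +
          Q.contractMap a ha (Q.superDeriv (Sum.inr a) γ) * Q.momentTerm a ha s δ b) +
      (Q.crossTerm a ha s γ δ b +
        (-1 : ℂ) ^ ((r + 1) * (s + 1)) • Q.crossTerm a ha r δ γ b) := by
  have h_deriv {n : ℕ} {ζ : Q.Necklace} (hζ : ζ ∈ Q.necklaceGrade n) (y : E ⊕ E) :=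
    Q.contractMap_mem_parityGrade a ha (Q.superDeriv_mem_parityGrade y hζ)
  rw [superDeriv_inr_contractNecklace Q a ha b hγ, superDeriv_inl_contractNecklace Q a ha b hδ]
  exact mkQ_corrected_mul _ _ ((Q.contract a ha).arrow_mem_parityGrade (Sum.inl b))
    ((Q.contract a ha).arrow_mem_parityGrade (Sum.inr b)) (h_deriv hγ (Sum.inr b))
    (h_deriv hγ (Sum.inr a)) (h_deriv hδ (Sum.inl b)) (h_deriv hδ (Sum.inr b))
    (h_deriv hδ (Sum.inr a))

theorem schouten_eq_sum (r s : ℕ) (γ δ : Q.Necklace) :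
    Q.schouten r s γ δ =
      ∑ b, (Q.superCommutators.mkQ (Q.superDeriv (Sum.inr b) γ * Q.superDeriv (Sum.inl b) δ) -
        (-1 : ℂ) ^ ((r + 1) * (s + 1)) •
          Q.superCommutators.mkQ (Q.superDeriv (Sum.inr b) δ * Q.superDeriv (Sum.inl b) γ)) := by
  have h_sign : (-1 : ℂ) ^ (((r : ℤ) - 1) * ((s : ℤ) - 1)) = (-1) ^ ((r + 1) * (s + 1)) := by
    have h_even : Even (((r : ℤ) - 1) * ((s : ℤ) - 1) - ((r + 1) * (s + 1) : ℕ)) :=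
      ⟨-(r + s), by push_cast; ring⟩
    rw [← zpow_natCast, ← sub_add_cancel (((r : ℤ) - 1) * ((s : ℤ) - 1)) ((r + 1) * (s + 1) : ℕ),
      zpow_add₀ (neg_ne_zero.2 one_ne_zero), h_even.neg_one_zpow, one_mul]
  simp only [schouten, h_sign, map_sum, map_sub, map_smul]

theorem contractNecklace_mkQ_superDeriv_mul_superDeriv (b : E) (γ δ : Q.Necklace) :
    Q.contractNecklace a ha (Q.superCommutators.mkQ
        (Q.superDeriv (Sum.inr b) γ * Q.superDeriv (Sum.inl b) δ)) =
      (Q.contract a ha).superCommutators.mkQ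
        (Q.contractMap a ha (Q.superDeriv (Sum.inr b) γ) *
          Q.contractMap a ha (Q.superDeriv (Sum.inl b) δ)) := by
  have hγ := Q.superDeriv_mem_corner (Sum.inr b) γ
  have hδ := Q.superDeriv_mem_corner (Sum.inl b) δ
  rw [contractNecklace_mkQ Q a ha (mul_mem_corner hγ hδ), contractMap_mul Q a ha hγ hδ]

end Reduction

end ArrowQuiver

end

open ArrowQuiver in
theorem mainTheorem4_general {I E : Type*} [Fintype I] [DecidableEq I] [Fintype E] [DecidableEq E]
    (Q : ArrowQuiver I E) (a : E) (ha : Q.head a ≠ Q.tail a) {r s : ℕ} {γ δ : Q.Necklace}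
    (hγ : γ ∈ Q.necklaceGrade r) (hδ : δ ∈ Q.necklaceGrade s) :
    (Q.contract a ha).schouten r s (Q.contractNecklace a ha γ) (Q.contractNecklace a ha δ) =
      Q.contractNecklace a ha (Q.schouten r s γ δ) := by
  rw [schouten_eq_sum, schouten_eq_sum, map_sum, Fintype.sum_eq_add_sum_subtype_ne _ a]
  simp only [map_sub, map_smul, contractNecklace_mkQ_superDeriv_mul_superDeriv,
    mkQ_superDeriv_mul_superDeriv_contractNecklace Q a ha hγ hδ,
    mkQ_superDeriv_mul_superDeriv_contractNecklace Q a ha hδ hγ]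
  rw [← sum_momentTerm Q a ha hγ, ← sum_momentTerm Q a ha hδ]
  simp only [Finset.mul_sum, map_sum, Finset.smul_sum, ← Finset.sum_sub_distrib,
    ← Finset.sum_add_distrib]
  refine Finset.sum_congr rfl fun b _ => ?_
  simp only [mul_comm (s + 1), smul_add, smul_smul, neg_one_pow_mul_self, one_smul, map_add]
  abel

theorem mainTheorem4 {I E : Type*} [Fintype I] [DecidableEq I] [Fintype E] [DecidableEq E]
    (Q : ArrowQuiver I E) (a : E) (ha : Q.head a ≠ Q.tail a)
    (P : Q.Necklace) (hP : Q.IsPoisson P) :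
    (Q.contract a ha).IsPoisson (Q.contractNecklace a ha P) :=
  ⟨Q.contractNecklace_mem_necklaceGrade a ha hP.1, by
    rw [mainTheorem4_general Q a ha hP.1 hP.1, hP.2, map_zero]⟩
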